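/- **Theorem 2.3 (A priori estimates).** Let $f\in C^2(\mathbb R)$ satisfy $|f''(u)|\le K(1+|u|^q)$ for all $u\in\mathbb R$, with some constants $K$ and $0\le q\le 5$. Let $\tilde u,\delta\in\mathbb R$ and $\nu>0$, and let $\psi_0\in H^2=H^2(\mathbb R)$ be real-valued. Then there is a constant $C_{\psi_0}>0$, which may depend on $f,q,\tilde u,\delta,\nu$ and $\psi_0$ but not on $T$, such that the following holds. Let $T>0$ and let $\psi\in C^0([0,T];H^2)$ with $\partial_x^2\psi\in L^2(0,T;H^2)$ be a solution of $$\partial_t\psi+\partial_x\bigl(f(\psi+\tilde u)\bigr)=-\delta\,\partial_x^3\psi-\nu\,\partial_x^4\psi\quad(0<t<T,\ x\in\mathbb R),\qquad \psi(0,\cdot)=\psi_0 ,$$ where the equation is understood in the sense of distributions, that is, for every $\varphi\in C_c^\infty(\mathbb R)$ and every $t\in[0,T]$, $$\int_{\mathbb R}\psi(t)\varphi\,dx-\int_{\mathbb R}\psi(0)\varphi\,dx=\int_0^t\Bigl(\int_{\mathbb R} f(\psi+\tilde u)\,\varphi'\,dx+\delta\int_{\mathbb R}\psi\,\varphi'''\,dx-\nu\int_{\mathbb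 R}\psi\,\varphi''''\,dx\Bigr)ds .$$ Then for all $t\in[0,T]$ $$\|\psi(t)\|_{H^2}^2+\int_0^t\|\partial_x^2\psi(\tau)\|_{H^2}^2\,d\tau+\int_0^t\|\psi(\tau)\|_{L^\infty}^8\,d\tau+\int_0^t\|\partial_x\psi(\tau)\|_{L^\infty}^{8/3}\,d\tau\le C_{\psi_0}.$$ Here $\|u\|_{H^2}^2=\|u\|_{L^2}^2+\|\partial_xu\|_{L^2}^2+\|\partial_x^2u\|_{L^2}^2$. -/

import Mathlib

open MeasureTheory Set
open scoped ENNReal ContDiff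

noncomputable section

namespace DispersiveDiffusive

/-- The real Lebesgue space `L²(ℝ)`. -/
abbrev L2 : Type := Lp ℝ 2 (volume : Measure ℝ)

/-- Test functions on `ℝ`: real-valued, smooth, with compact support. -/
def IsTest (φ : ℝ → ℝ) : Prop :=
  ContDiff ℝ ∞ φ ∧ HasCompactSupport φ

theorem IsTest.memLp_deriv {φ : ℝ → ℝ} (hφ : IsTest φ) : MemLp (deriv φ) 2 volume :=
  (hφ.1.continuous_deriv (by simp)).memLp_of_hasCompactSupport hφ.2.deriv

theorem IsTest.memLp {φ : ℝ → ℝ} (hφ : IsTest φ) : MemLp φ 2 volume :=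
  hφ.1.continuous.memLp_of_hasCompactSupport hφ.2

/-- `v` is the weak derivative of `u`, for `u v ∈ L²(ℝ)`. -/
def HasWeakDeriv (u v : L2) : Prop :=
  ∀ φ : ℝ → ℝ, IsTest φ → ∫ x, u x * deriv φ x = -∫ x, v x * φ x

theorem integral_add_mul (u v : L2) {g : ℝ → ℝ} (hg : MemLp g 2 volume) :
    ∫ x, (u + v : L2) x * g x = (∫ x, u x * g x) + ∫ x, v x * g x := by
  have hu : Integrable (fun x => u x * g x) := (Lp.memLp u).integrable_mul hg
  have hv : Integrable (fun x => v x * g x) := (Lp.memLp v).integrable_mul hg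
  rw [← integral_add hu hv]
  refine integral_congr_ae ?_
  filter_upwards [Lp.coeFn_add u v] with x hx
  rw [hx, Pi.add_apply, add_mul]

theorem integral_smul_mul (c : ℝ) (u : L2) (g : ℝ → ℝ) :
    ∫ x, (c • u : L2) x * g x = c * ∫ x, u x * g x := by
  rw [← integral_const_mul]
  refine integral_congr_ae ?_
  filter_upwards [Lp.coeFn_smul c u] with x hx
  rw [hx, Pi.smul_apply, smul_eq_mul, mul_assoc]

theorem HasWeakDeriv.zero : HasWeakDeriv 0 0 := by
  intro φ _
  have h (g : ℝ → ℝ) : ∫ x, (0 : L2) x * g x = 0 := by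
    have := integral_smul_mul 0 0 g
    rwa [zero_smul, zero_mul] at this
  rw [h, h, neg_zero]

theorem HasWeakDeriv.add {u u' v v' : L2} (hu : HasWeakDeriv u u') (hv : HasWeakDeriv v v') :
    HasWeakDeriv (u + v) (u' + v') := by
  intro φ hφ
  rw [integral_add_mul _ _ hφ.memLp_deriv, integral_add_mul _ _ hφ.memLp, hu φ hφ, hv φ hφ]
  ring

theorem HasWeakDeriv.smul (c : ℝ) {u u' : L2} (hu : HasWeakDeriv u u') :
    HasWeakDeriv (c • u) (c • u') := by
  intro φ hφ
  rw [integral_smul_mul, integral_smul_mul, hu φ hφ]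
  ring

/-- The Sobolev space `H^k(ℝ)` with its Hilbert norm. A function `u ∈ H^k(ℝ)` is recorded together
with its weak derivatives as the tuple `(u, ∂ₓu, …, ∂ₓᵏu)` of elements of `L²(ℝ)`. Since `u`
determines its weak derivatives, this is the usual space, and the norm inherited from the
`ℓ²`-product is the usual one, `‖u‖² = ∑ j ≤ k, ‖∂ₓʲu‖²` with `L²` norms on the right. -/
def H (k : ℕ) : Submodule ℝ (PiLp 2 (fun _ : Fin (k + 1) => L2)) where
  carrier := {U | ∀ i : Fin k, HasWeakDeriv (U i.castSucc) (U i.succ)}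
  zero_mem' := fun _ => HasWeakDeriv.zero
  add_mem' := fun hU hV i => (hU i).add (hV i)
  smul_mem' := fun c _ hU i => (hU i).smul c

/-- `∂ₓʲu ∈ L²(ℝ)` for `u ∈ H^k(ℝ)` and `j ≤ k`. -/
def dx {k : ℕ} (j : Fin (k + 1)) (u : H k) : L2 := (u : PiLp 2 (fun _ : Fin (k + 1) => L2)) j

/-- The `L^∞(ℝ)` norm. -/
def supNorm (u : L2) : ℝ≥0∞ := eLpNorm u ∞ volume

/-- `ψ ∈ C⁰([0,T]; H²)` with `∂ₓ²ψ = χ ∈ L²(0,T; H²)` solves the Cauchy problem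
`∂ₜψ + ∂ₓ(f(ψ + ũ)) = -δ ∂ₓ³ψ - ν ∂ₓ⁴ψ`, `ψ(0) = ψ₀`, on `[0,T]`. The equation is meant in the sense
of distributions: it is tested with smooth compactly supported functions of `x`, all derivatives in
`x` are moved to the test function, and the equation is integrated in time. -/
structure IsSolution (f : ℝ → ℝ) (uInf δ ν : ℝ) (ψ₀ : H 2) (T : ℝ) (ψ χ : ℝ → H 2) : Prop where
  continuousOn : ContinuousOn ψ (Icc 0 T)
  memLp : MemLp χ 2 (volume.restrict (Ioo 0 T))
  dxx_eq : ∀ᵐ t ∂(volume.restrict (Ioo 0 T)), dx 0 (χ t) = dx 2 (ψ t)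
  initial : ψ 0 = ψ₀
  equation : ∀ φ : ℝ → ℝ, IsTest φ → ∀ t ∈ Icc 0 T,
    (∫ x, dx 0 (ψ t) x * φ x) - ∫ x, dx 0 (ψ 0) x * φ x =
      ∫ s in (0 : ℝ)..t,
        ((∫ x, f (dx 0 (ψ s) x + uInf) * deriv φ x)
          + δ * (∫ x, dx 0 (ψ s) x * iteratedDeriv 3 φ x)
          - ν * ∫ x, dx 0 (ψ s) x * iteratedDeriv 4 φ x)

end DispersiveDiffusive

end

/-!
For a solution, `∂ₜψ = -∂ₓ(f(ψ + ũ)) - δ ∂ₓ³ψ - ν ∂ₓ⁴ψ` belongs to `L²(0,T; L²)`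
(`IsSolution.sub_eq_integral_timeDeriv`), so `ψ` may be tested with itself and with `∂ₓ⁴ψ`.

Testing with `ψ` removes convection and dispersion, both being total derivatives, and leaves
`‖ψ(t)‖² + 2ν ∫₀ᵗ ‖∂ₓ²ψ‖² ≤ ‖ψ₀‖²` in `L²` norms (`IsSolution.norm_sq_add_integral_le`). Write
`Y = ‖∂ₓ²ψ‖²`. Agmon's inequality and interpolation give `‖ψ‖_∞⁸ ≲ Y` and `‖∂ₓψ‖_∞^(8/3) ≲ Y`,
with constants depending only on `‖ψ₀‖`, so these powers are integrable in time, uniformly in `T`.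

Testing with `∂ₓ⁴ψ` requires a bound of `⟨∂ₓ(f(ψ + ũ)), ∂ₓ⁴ψ⟩` that is `O(Y)` for small `Y`, since
otherwise its time integral is not controlled uniformly in `T`, and `O(Y²)` for large `Y`. The
linear part `f'(ũ) ∂ₓψ` of the flux drops out; after one integration by parts the rest is
`-∫ (f''(ψ + ũ) (∂ₓψ)² + (f'(ψ + ũ) - f'(ũ)) ∂ₓ²ψ) ∂ₓ³ψ`, and the inequalities above together with
the growth of order at most `5` of `f''` bound it by
`C (Y + Y²) + (ν/2) ‖∂ₓ⁴ψ‖²` (`exists_abs_integral_convection_le`). Hence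
`Y(t) + ν ∫₀ᵗ ‖∂ₓ⁴ψ‖² ≤ Y(0) + 2C ∫₀ᵗ (Y + Y²)`. As `∫ Y` is already bounded, Grönwall's inequality
with the integrable coefficient `Y` bounds `Y` and then `∫ ‖∂ₓ⁴ψ‖²`.

Both balances come from one energy inequality for `L²(0,T)` functions with values in a Hilbert space
(`norm_sq_sub_norm_sq_le`), and all identities in `x` come from the locally absolutely continuous
representatives of functions with a weak derivative (`HasWeakDeriv.exists_isPrimitive`).
-/

noncomputable section

namespace DispersiveDiffusive

open Filter Topology

/-! ### Absolutely continuous functions and weak derivatives -/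

/-- `w` is locally absolutely continuous on `ℝ` with a.e. derivative `v`. -/
structure IsPrimitive (w v : ℝ → ℝ) : Prop where
  ac : ∀ a b, AbsolutelyContinuousOnInterval w a b
  deriv : ∀ᵐ x, HasDerivAt w (v x) x

theorem _root_.AbsolutelyContinuousOnInterval.comp_contDiff {G w : ℝ → ℝ} {a b : ℝ}
    (hw : AbsolutelyContinuousOnInterval w a b) (hG : ContDiff ℝ 1 G) :
    AbsolutelyContinuousOnInterval (fun x => G (w x)) a b := by
  obtain ⟨R, hR⟩ := hw.exists_bound
  obtain ⟨K, hK⟩ := hG.contDiffOn.exists_lipschitzOnWith (by decide)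
    (convex_Icc (-R) R) isCompact_Icc
  have hmem : ∀ x ∈ uIcc a b, w x ∈ Icc (-R) R := fun x hx => abs_le.1 (hR x hx)
  unfold AbsolutelyContinuousOnInterval at hw ⊢
  have h1 := hw.const_mul (K : ℝ)
  rw [mul_zero] at h1
  refine squeeze_zero' (Eventually.of_forall fun E => Finset.sum_nonneg fun _ _ => dist_nonneg)
    ?_ h1
  filter_upwards [mem_inf_of_right (mem_principal_self _)] with E hE
  rw [Finset.mul_sum]
  refine Finset.sum_le_sum fun i hi => ?_
  have := hE.1 i hi
  exact hK.dist_le_mul _ (hmem _ this.1) _ (hmem _ this.2)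

namespace IsPrimitive

variable {w v w' v' : ℝ → ℝ}

theorem continuous (h : IsPrimitive w v) : Continuous w := by
  rw [continuous_iff_continuousAt]
  intro x
  have := (h.ac (x - 1) (x + 1)).continuousOn
  rw [uIcc_of_le (by linarith)] at this
  exact this.continuousAt (Icc_mem_nhds (by linarith) (by linarith))

theorem congr (h : IsPrimitive w v) (hv : v =ᵐ[volume] v') : IsPrimitive w v' :=
  ⟨h.ac, by filter_upwards [h.deriv, hv] with x hx hx'; rwa [← hx']⟩

theorem sub_eq (h : IsPrimitive w v) (a b : ℝ) : w b - w a = ∫ x in a..b, v x := by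
  rw [← (h.ac a b).integral_deriv_eq_sub]
  refine intervalIntegral.integral_congr_ae ?_
  filter_upwards [h.deriv] with x hx _ using hx.deriv

theorem mul (h : IsPrimitive w v) (h' : IsPrimitive w' v') :
    IsPrimitive (fun x => w x * w' x) (fun x => v x * w' x + w x * v' x) :=
  ⟨fun a b => (h.ac a b).fun_mul (h'.ac a b), by
    filter_upwards [h.deriv, h'.deriv] with x hx hx' using hx.mul hx'⟩

theorem of_contDiff {φ : ℝ → ℝ} (h : ContDiff ℝ 1 φ) : IsPrimitive φ (_root_.deriv φ) :=
  ⟨fun _ _ => h.contDiffOn.absolutelyContinuousOnInterval,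
    ae_of_all _ fun x => (h.differentiable (by simp) x).hasDerivAt⟩

theorem comp {G : ℝ → ℝ} (h : IsPrimitive w v) (hG : ContDiff ℝ 1 G) :
    IsPrimitive (fun x => G (w x)) (fun x => _root_.deriv G (w x) * v x) :=
  ⟨fun a b => (h.ac a b).comp_contDiff hG, by
    filter_upwards [h.deriv] with x hx using
      (hG.differentiable (by simp) (w x)).hasDerivAt.comp x hx⟩

theorem of_integral (hv : LocallyIntegrable v) (c : ℝ) :
    IsPrimitive (fun x => (∫ t in (0 : ℝ)..x, v t) + c) v := by
  have hi (x y : ℝ) : IntervalIntegrable v volume x y :=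
    intervalIntegrable_iff.mpr <|
      (hv.integrableOn_isCompact isCompact_uIcc).mono_set uIoc_subset_uIcc
  constructor
  · intro a b
    have h0 : AbsolutelyContinuousOnInterval (fun x => ∫ t in a..x, v t) a b :=
      (hi a b).absolutelyContinuousOnInterval_intervalIntegral (by simp)
    have h1 : AbsolutelyContinuousOnInterval (fun _ => (∫ t in (0 : ℝ)..a, v t) + c) a b :=
      (contDiff_const (n := 1)).contDiffOn.absolutelyContinuousOnInterval
    have h2 : (fun x => (∫ t in (0 : ℝ)..x, v t) + c) =
        (fun x => ∫ t in a..x, v t) + fun _ => (∫ t in (0 : ℝ)..a, v t) + c := by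
      funext x
      simp only [Pi.add_apply]
      rw [← intervalIntegral.integral_add_adjacent_intervals (hi 0 a) (hi a x)]
      ring
    rw [h2]
    exact h0.add h1
  · filter_upwards [LocallyIntegrable.ae_hasDerivAt_integral hv] with x hx
    exact (hx 0).add_const c

/-- The limit exists because the derivative is integrable, and it is `0` because the function itself
is integrable. -/
theorem tendsto_atBot (h : IsPrimitive w v) (hw : Integrable w) (hv : Integrable v) :
    Tendsto w atBot (𝓝 0) := by
  have h1 : Tendsto (fun a => w 0 - ∫ x in a..0, v x) atBot (𝓝 (w 0 - ∫ x in Iic 0, v x)) :=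
    tendsto_const_nhds.sub (intervalIntegral_tendsto_integral_Iic 0 hv.integrableOn tendsto_id)
  have h2 : Tendsto w atBot (𝓝 (w 0 - ∫ x in Iic 0, v x)) :=
    h1.congr fun a => by rw [← h.sub_eq]; ring
  have h3 := IntegrableAtFilter.eq_zero_of_tendsto (μ := volume) (hw.integrableAtFilter atBot)
    (fun s hs => by
      obtain ⟨a, ha⟩ := mem_atBot_sets.1 hs
      exact top_unique (Real.volume_Iic (a := a) ▸ measure_mono ha)) h2
  rwa [h3] at h2

theorem tendsto_atTop (h : IsPrimitive w v) (hw : Integrable w) (hv : Integrable v) :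
    Tendsto w atTop (𝓝 0) := by
  have h1 : Tendsto (fun a => w 0 + ∫ x in (0:ℝ)..a, v x) atTop (𝓝 (w 0 + ∫ x in Ioi 0, v x)) :=
    tendsto_const_nhds.add (intervalIntegral_tendsto_integral_Ioi 0 hv.integrableOn tendsto_id)
  have h2 : Tendsto w atTop (𝓝 (w 0 + ∫ x in Ioi 0, v x)) :=
    h1.congr fun a => by rw [← h.sub_eq]; ring
  have h3 := IntegrableAtFilter.eq_zero_of_tendsto (μ := volume) (hw.integrableAtFilter atTop)
    (fun s hs => by
      obtain ⟨a, ha⟩ := mem_atTop_sets.1 hs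
      exact top_unique (Real.volume_Ici (a := a) ▸ measure_mono ha)) h2
  rwa [h3] at h2

theorem eq_integral_Iic (h : IsPrimitive w v) (hw : Integrable w) (hv : Integrable v) (x : ℝ) :
    w x = ∫ y in Iic x, v y := by
  have h1 := intervalIntegral_tendsto_integral_Iic x hv.integrableOn tendsto_id
  have h2 : Tendsto (fun a => w x - w a) atBot (𝓝 (w x - 0)) :=
    tendsto_const_nhds.sub (h.tendsto_atBot hw hv)
  rw [sub_zero] at h2
  exact tendsto_nhds_unique h2 (h1.congr fun a => (h.sub_eq a x).symm)

/-- For a product of two functions, this is integration by parts on `ℝ`. -/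
theorem integral_eq_zero (h : IsPrimitive w v) (hw : Integrable w) (hv : Integrable v) :
    ∫ x, v x = 0 := by
  have h1 := intervalIntegral_tendsto_integral hv tendsto_neg_atTop_atBot tendsto_id
  have h2 : Tendsto (fun a => w a - w (-a)) atTop (𝓝 (0 - 0)) :=
    (h.tendsto_atTop hw hv).sub ((h.tendsto_atBot hw hv).comp tendsto_neg_atTop_atBot)
  rw [sub_zero] at h2
  exact tendsto_nhds_unique (h1.congr fun a => (h.sub_eq (-a) a).symm) h2

end IsPrimitive

theorem IsTest.deriv {φ : ℝ → ℝ} (hφ : IsTest φ) : IsTest (deriv φ) :=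
  ⟨(contDiff_infty_iff_deriv.1 hφ.1).2, hφ.2.deriv⟩

/-- A test function of zero mean is the derivative of a test function. -/
theorem IsTest.exists_deriv_eq {θ : ℝ → ℝ} (hθ : IsTest θ) (h0 : ∫ x, θ x = 0) :
    ∃ φ, IsTest φ ∧ _root_.deriv φ = θ := by
  have hc := hθ.1.continuous
  have hint : Integrable θ := hc.integrable_of_hasCompactSupport hθ.2
  have hd : ∀ x, HasDerivAt (fun x => ∫ t in (0:ℝ)..x, θ t) (θ x) x := fun x =>
    intervalIntegral.integral_hasDerivAt_right (hc.intervalIntegrable _ _)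
      hc.stronglyMeasurable.stronglyMeasurableAtFilter hc.continuousAt
  obtain ⟨R, hR⟩ := hθ.2.isCompact.isBounded.subset_closedBall 0
  have hz : ∀ x, R < |x| → θ x = 0 := fun x hx => by
    by_contra h
    have := hR (subset_tsupport _ h)
    simp at this
    linarith
  set c := ∫ t in (-(|R|+1))..0, θ t with hcdef
  have hval : ∀ x, (∫ t in (0:ℝ)..x, θ t) + c = ∫ t in (-(|R|+1))..x, θ t := fun x => by
    rw [add_comm, hcdef, intervalIntegral.integral_add_adjacent_intervals
      (hc.intervalIntegrable _ _) (hc.intervalIntegrable _ _)]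
  have hder : _root_.deriv (fun x => (∫ t in (0:ℝ)..x, θ t) + c) = θ :=
    funext fun x => ((hd x).add_const c).deriv
  refine ⟨fun x => (∫ t in (0:ℝ)..x, θ t) + c, ⟨?_, ?_⟩, hder⟩
  · rw [contDiff_infty_iff_deriv, hder]
    exact ⟨fun x => ((hd x).add_const c).differentiableAt, hθ.1⟩
  · refine HasCompactSupport.intro (isCompact_Icc (a := -(|R|+1)) (b := |R|+1)) fun x hx => ?_
    rw [hval]
    have hRle := le_abs_self R
    simp only [mem_Icc, not_and_or, not_le] at hx
    rcases hx with hx | hx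
    · rw [intervalIntegral.integral_symm, intervalIntegral.integral_of_le hx.le,
        setIntegral_eq_zero_of_forall_eq_zero, neg_zero]
      intro t ht
      refine hz t (lt_abs.2 (Or.inr ?_))
      linarith [ht.2]
    · rw [← h0, intervalIntegral.integral_of_le (by linarith [abs_nonneg R])]
      refine setIntegral_eq_integral_of_forall_compl_eq_zero fun t ht => hz t ?_
      simp only [mem_Ioc, not_and_or, not_le, not_lt] at ht
      rw [lt_abs]
      rcases ht with ht | ht
      · right; linarith
      · left; linarith

/-- A locally integrable function with zero distributional derivative is a.e. constant. -/
theorem ae_eq_const_of_forall_integral_deriv {w : ℝ → ℝ} (hw : LocallyIntegrable w)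
    (h : ∀ φ, IsTest φ → ∫ x, w x * deriv φ x = 0) : ∃ c, ∀ᵐ x, w x = c := by
  obtain ⟨ρ, hρ1, hρ2⟩ : ∃ ρ : ℝ → ℝ, IsTest ρ ∧ ∫ x, ρ x = 1 := by
    let b : ContDiffBump (0 : ℝ) := ⟨1, 2, by norm_num, by norm_num⟩
    exact ⟨b.normed volume, ⟨b.contDiff_normed, b.hasCompactSupport_normed⟩, b.integral_normed⟩
  have hi : ∀ θ : ℝ → ℝ, IsTest θ → Integrable (fun x => θ x * w x) := fun θ hθ =>
    hw.integrable_smul_left_of_hasCompactSupport hθ.1.continuous hθ.2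
  refine ⟨∫ x, ρ x * w x, ae_eq_of_integral_contDiff_smul_eq hw
    (continuous_const.locallyIntegrable) fun θ hθ hθc => ?_⟩
  have hθi : Integrable θ := hθ.continuous.integrable_of_hasCompactSupport hθc
  have hρi : Integrable ρ := hρ1.1.continuous.integrable_of_hasCompactSupport hρ1.2
  have ht : IsTest (fun x => θ x - (∫ y, θ y) * ρ x) :=
    ⟨hθ.sub (contDiff_const.mul hρ1.1), hθc.sub (hρ1.2.mul_left (f := fun _ => ∫ y, θ y))⟩
  obtain ⟨φ, hφ, hφd⟩ := ht.exists_deriv_eq (by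
    rw [integral_sub hθi (hρi.const_mul _), integral_const_mul, hρ2, mul_one, sub_self])
  have h1 := h φ hφ
  rw [hφd] at h1
  have h2 : ∀ x, w x * (θ x - (∫ y, θ y) * ρ x) = θ x * w x - (∫ y, θ y) * (ρ x * w x) :=
    fun x => by ring
  simp only [h2] at h1
  rw [integral_sub (hi θ ⟨hθ, hθc⟩) ((hi ρ hρ1).const_mul _), integral_const_mul, sub_eq_zero] at h1
  simp only [smul_eq_mul]
  rw [h1, integral_mul_const]

/-- An element of `L²(ℝ)` with a weak derivative in `L²(ℝ)` has a locally absolutely continuous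
representative. -/
theorem HasWeakDeriv.exists_isPrimitive {u v : L2} (h : HasWeakDeriv u v) :
    ∃ w : ℝ → ℝ, u =ᵐ[volume] w ∧ IsPrimitive w v := by
  have hu : LocallyIntegrable u := (Lp.memLp u).locallyIntegrable (by norm_num)
  have hv : LocallyIntegrable v := (Lp.memLp v).locallyIntegrable (by norm_num)
  have hV := IsPrimitive.of_integral hv 0
  simp only [add_zero] at hV
  obtain ⟨c, hc⟩ := ae_eq_const_of_forall_integral_deriv
    (hu.sub hV.continuous.locallyIntegrable) (fun φ hφ => by
      have hφ1 : ContDiff ℝ 1 φ := hφ.1.of_le (by simp)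
      have hp := hV.mul (IsPrimitive.of_contDiff hφ1)
      have i1 : Integrable (fun x => v x * φ x) := (Lp.memLp v).integrable_mul hφ.memLp
      have i2 : Integrable (fun x => (∫ t in (0:ℝ)..x, v t) * deriv φ x) :=
        (hV.continuous.mul hφ.deriv.1.continuous).integrable_of_hasCompactSupport
          (hφ.deriv.2.mul_left)
      have i3 : Integrable (fun x => u x * deriv φ x) := (Lp.memLp u).integrable_mul hφ.memLp_deriv
      have h0 := hp.integral_eq_zero
        ((hV.continuous.mul hφ.1.continuous).integrable_of_hasCompactSupport hφ.2.mul_left)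
        (i1.add i2)
      rw [integral_add i1 i2] at h0
      simp only [Pi.sub_apply, sub_mul]
      rw [integral_sub i3 i2, h φ hφ]
      linarith)
  refine ⟨_, ?_, IsPrimitive.of_integral hv c⟩
  filter_upwards [hc] with x hx
  simp only [Pi.sub_apply] at hx
  linarith

/-! ### The energy inequality in a Hilbert space -/

section Energy

variable {E : Type*} [NormedAddCommGroup E] [InnerProductSpace ℝ E]

theorem integrable_inner_of_memLp {F G : ℝ → E} {μ : Measure ℝ} (hF : MemLp F 2 μ)
    (hG : MemLp G 2 μ) : Integrable (fun t => inner ℝ (F t) (G t)) μ :=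
  (hF.norm.integrable_mul hG.norm).mono' (hF.aestronglyMeasurable.inner hG.aestronglyMeasurable)
    (ae_of_all _ fun _ => norm_inner_le_norm _ _)

/-- Translations act continuously on square integrable functions. -/
theorem continuous_integral_inner_translate {G A : ℝ → E} (hG : MemLp G 2 volume)
    (hA : MemLp A 2 volume) : Continuous fun s : ℝ => ∫ t, inner ℝ (G (t - s)) (A t) := by
  have : Fact ((2 : ℝ≥0∞) ≠ ⊤) := ⟨by norm_num⟩
  have hc : Continuous fun s : ℝ =>
      inner ℝ (DomAddAct.mk (-s) +ᵥ hG.toLp G) (hA.toLp A) := by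
    have h1 : Continuous fun s : ℝ => DomAddAct.mk (-s) :=
      DomAddAct.continuous_mk.comp continuous_neg
    exact (h1.vadd continuous_const).inner continuous_const
  refine hc.congr fun s => ?_
  rw [L2.inner_def]
  refine integral_congr_ae ?_
  filter_upwards [DomAddAct.vadd_Lp_ae_eq (DomAddAct.mk (-s)) (hG.toLp G), hA.coeFn_toLp,
    (measurePreserving_add_left volume (-s)).quasiMeasurePreserving.ae_eq_comp hG.coeFn_toLp]
    with t h1 h2 h3
  rw [h1, h2]
  simp only [Function.comp_apply, neg_add_eq_sub] at h3
  simp [h3, neg_add_eq_sub]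

theorem integral_integral_inner_translate [CompleteSpace E] {G A : ℝ → E} (hG : Integrable G)
    (hA : Integrable A) (h : ℝ) :
    ∫ s in (0 : ℝ)..h, ∫ t, inner ℝ (G (t - s)) (A t) =
      ∫ t, inner ℝ (∫ s in (t - h)..t, G s) (A t) := by
  have hG' : Integrable fun x => G (-x) := hG.comp_neg
  have hI := (hA.convolution_integrand (μ := volume) (ν := volume) (innerSL ℝ) hG')
  have hI2 : Integrable (Function.uncurry fun s t : ℝ => inner ℝ (G (t - s)) (A t))
      ((volume.restrict (uIoc 0 h)).prod volume) := by
    refine (hI.congr (ae_of_all _ fun p => ?_)).mono_measure (Measure.prod_mono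
      Measure.restrict_le_self le_rfl)
    simp only [Function.uncurry, neg_sub]
    exact real_inner_comm _ _
  rw [intervalIntegral_integral_swap hI2]
  refine integral_congr_ae (ae_of_all _ fun t => ?_)
  have h1 : IntervalIntegrable (fun s => G (t - s)) volume 0 h :=
    (hG.comp_sub_left t).intervalIntegrable
  simp only [real_inner_comm (A t)]
  have := (innerSL ℝ (A t)).intervalIntegral_comp_comm h1
  simp only [innerSL_apply_apply] at this
  rw [this, intervalIntegral.integral_comp_sub_left, sub_zero]

variable [CompleteSpace E]

/-- If `∂ₜu = g` and `A` represents `P` in the sense of `hPA` (in the applications `P = ∂ₓᵏu` and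
`A = (-1)ᵏ ∂ₓ²ᵏu`), then `‖P‖²` grows at most at the rate `2⟨g, A⟩`. The increment over
`[t - h, t]` satisfies
`‖P(t)‖² - ‖P(t - h)‖² ≤ 2⟨P(t) - P(t - h), P(t)⟩ = 2⟨u(t) - u(t - h), A(t)⟩`. This is integrated
over `t` and divided by `h → 0`; the limit exists because translations act continuously on `L²`. -/
theorem norm_sq_sub_norm_sq_le {T : ℝ} (hT : 0 ≤ T) {u P g A : ℝ → E}
    (hP : ContinuousOn P (Icc 0 T)) (hg : MemLp g 2 (volume.restrict (Ioo 0 T)))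
    (hA : MemLp A 2 (volume.restrict (Ioo 0 T)))
    (hu : ∀ t ∈ Icc 0 T, u t - u 0 = ∫ s in (0 : ℝ)..t, g s)
    (hPA : ∀ᵐ t ∂(volume.restrict (Ioo 0 T)), ∀ s ∈ Icc 0 T,
      inner ℝ (P t - P s) (P t) = inner ℝ (u t - u s) (A t)) :
    ‖P T‖ ^ 2 - ‖P 0‖ ^ 2 ≤ 2 * ∫ s in Ioo 0 T, inner ℝ (g s) (A s) := by
  set G := (Ioo 0 T).indicator g with hGdef
  set B := (Ioo 0 T).indicator A with hBdef
  have hG2 : MemLp G 2 volume := (memLp_indicator_iff_restrict measurableSet_Ioo).2 hg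
  have hB2 : MemLp B 2 volume := (memLp_indicator_iff_restrict measurableSet_Ioo).2 hA
  have hG1 : Integrable G := (integrable_indicator_iff measurableSet_Ioo).2
    (hg.integrable (by norm_num))
  have hB1 : Integrable B := (integrable_indicator_iff measurableSet_Ioo).2
    (hA.integrable (by norm_num))
  set Y : ℝ → ℝ := fun t => ‖P (projIcc 0 T hT t)‖ ^ 2 with hYdef
  have hYc : Continuous Y :=
    ((hP.comp_continuous (continuous_subtype_val.comp continuous_projIcc)
      fun t => (projIcc 0 T hT t).2).norm.pow 2)
  set Φ : ℝ → ℝ := fun s => ∫ t, inner ℝ (G (t - s)) (B t) with hΦdef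
  have hΦc : Continuous Φ := continuous_integral_inner_translate hG2 hB2
  have hΦ0 : Φ 0 = ∫ s in Ioo 0 T, inner ℝ (g s) (A s) := by
    rw [← integral_indicator measurableSet_Ioo]
    refine integral_congr_ae (ae_of_all _ fun t => ?_)
    by_cases ht : t ∈ Ioo 0 T <;> simp [hGdef, hBdef, ht]
  -- increments of `u` in terms of `G`
  have hGu : ∀ t ∈ Icc 0 T, ∫ s in (0:ℝ)..t, G s = u t - u 0 := by
    intro t ht
    rw [hu t ht, intervalIntegral.integral_of_le ht.1, intervalIntegral.integral_of_le ht.1,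
      integral_Ioc_eq_integral_Ioo, integral_Ioc_eq_integral_Ioo]
    exact setIntegral_congr_fun measurableSet_Ioo fun s hs =>
      indicator_of_mem (Ioo_subset_Ioo_right ht.2 hs) _
  have hGneg : ∀ t ≤ 0, ∫ s in (0:ℝ)..t, G s = 0 := by
    intro t ht
    rw [intervalIntegral.integral_of_ge ht, setIntegral_eq_zero_of_forall_eq_zero, neg_zero]
    intro s hs
    exact indicator_of_notMem (fun h => absurd h.1 (not_lt.2 hs.2)) _
  have hinc : ∀ t ∈ Ioo 0 T, ∀ h > 0, ∫ s in (t-h)..t, G s =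
      u t - u (projIcc 0 T hT (t - h)) := by
    intro t ht h hh
    rw [← intervalIntegral.integral_interval_sub_left hG1.intervalIntegrable
      hG1.intervalIntegrable (a := 0), hGu t ⟨ht.1.le, ht.2.le⟩]
    rcases le_total (t - h) 0 with h0 | h0
    · rw [hGneg _ h0, projIcc_of_le_left hT h0, sub_zero]
    · have hm : t - h ∈ Icc 0 T := ⟨h0, by linarith [ht.2]⟩
      rw [hGu _ hm, projIcc_of_mem hT hm]
      abel
  have hineq : ∀ h > 0, (∫ t in (0:ℝ)..T, Y t) - ∫ t in (0:ℝ)..T, Y (t - h) ≤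
      2 * ∫ s in (0:ℝ)..h, Φ s := by
    intro h hh
    have hYh : Continuous fun t => Y (t - h) := hYc.comp (continuous_id.sub continuous_const)
    rw [integral_integral_inner_translate hG1 hB1, ← intervalIntegral.integral_sub
      (hYc.intervalIntegrable _ _) (hYh.intervalIntegrable _ _),
      intervalIntegral.integral_of_le hT, integral_Ioc_eq_integral_Ioo]
    have hsupp : ∫ t, inner ℝ (∫ s in (t-h)..t, G s) (B t) =
        ∫ t in Ioo 0 T, inner ℝ (∫ s in (t-h)..t, G s) (B t) := by
      refine (setIntegral_eq_integral_of_forall_compl_eq_zero fun t ht => ?_).symm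
      rw [hBdef, indicator_of_notMem ht, inner_zero_right]
    rw [hsupp, ← integral_const_mul]
    have hbd : Integrable (fun t => inner ℝ (∫ s in (t-h)..t, G s) (B t)) := by
      have hprim : Continuous fun t => ∫ s in (0:ℝ)..t, G s :=
        intervalIntegral.continuous_primitive (fun _ _ => hG1.intervalIntegrable) 0
      have hcont : Continuous fun t => ∫ s in (t-h)..t, G s := by
        have h1 : Continuous fun t : ℝ => t - h := continuous_id.sub continuous_const
        refine (hprim.sub (hprim.comp h1)).congr fun t => ?_
        exact intervalIntegral.integral_interval_sub_left hG1.intervalIntegrable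
          hG1.intervalIntegrable
      refine (hB1.norm.const_mul (∫ s, ‖G s‖)).mono'
        (hcont.aestronglyMeasurable.inner hB1.aestronglyMeasurable) (ae_of_all _ fun t => ?_)
      refine (norm_inner_le_norm _ _).trans (mul_le_mul_of_nonneg_right ?_ (norm_nonneg _))
      refine (intervalIntegral.norm_integral_le_integral_norm_uIoc).trans ?_
      exact setIntegral_le_integral hG1.norm (ae_of_all _ fun _ => norm_nonneg _)
    refine integral_mono_ae ?_ (hbd.integrableOn.const_mul 2) ?_
    · exact ((hYc.sub hYh).integrableOn_Icc
        (a := 0) (b := T)).mono_set Ioo_subset_Icc_self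
    filter_upwards [hPA, ae_restrict_mem measurableSet_Ioo] with t ht htT
    have h1 := ht _ (projIcc 0 T hT (t - h)).2
    rw [hinc t htT h hh, hBdef, indicator_of_mem htT, ← h1]
    simp only [hYdef, projIcc_of_mem hT ⟨htT.1.le, htT.2.le⟩]
    rw [inner_sub_left, real_inner_self_eq_norm_sq]
    have h2 := norm_sub_sq_real (P t) (P (projIcc 0 T hT (t - h)))
    rw [real_inner_comm] at h2
    have h3 := sq_nonneg ‖P t - P (projIcc 0 T hT (t - h))‖
    linarith
  have hdΦ : HasDerivAt (fun h => ∫ s in (0:ℝ)..h, Φ s) (Φ 0) 0 :=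
    intervalIntegral.integral_hasDerivAt_right (hΦc.intervalIntegrable _ _)
      hΦc.stronglyMeasurable.stronglyMeasurableAtFilter hΦc.continuousAt
  have hdY : ∀ x, HasDerivAt (fun h => ∫ s in (0:ℝ)..h, Y s) (Y x) x := fun x =>
    intervalIntegral.integral_hasDerivAt_right (hYc.intervalIntegrable _ _)
      hYc.stronglyMeasurable.stronglyMeasurableAtFilter hYc.continuousAt
  have hdY' : ∀ x, HasDerivAt (fun h => ∫ s in (0:ℝ)..(x - h), Y s) (-Y x) 0 := fun x => by
    have h1 : HasDerivAt (fun h : ℝ => x - h) (-1) 0 := by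
      simpa using (hasDerivAt_id (0:ℝ)).const_sub x
    have h2 := hdY (x - 0)
    have h3 := h2.comp 0 h1
    rw [sub_zero, mul_neg_one] at h3
    exact h3
  -- `F ≥ 0` on the right of `0` and `F 0 = 0`, so the right derivative of `F` at `0` is nonnegative
  set F : ℝ → ℝ := fun h => 2 * (∫ s in (0:ℝ)..h, Φ s) + (∫ s in (0:ℝ)..(T - h), Y s)
    - (∫ s in (0:ℝ)..(0 - h), Y s) - ∫ s in (0:ℝ)..T, Y s with hFdef
  have hFd : HasDerivAt F (2 * Φ 0 + -Y T - -Y 0) 0 :=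
    (((hdΦ.const_mul 2).add (hdY' T)).sub (hdY' 0)).sub_const _
  have hF0 : F 0 = 0 := by simp [hFdef]
  have hFpos : ∀ h > 0, 0 ≤ F h := by
    intro h hh
    have h1 := hineq h hh
    rw [intervalIntegral.integral_comp_sub_right, ← intervalIntegral.integral_interval_sub_left
      (hYc.intervalIntegrable 0 (T - h)) (hYc.intervalIntegrable 0 (0 - h))] at h1
    simp only [hFdef]
    linarith
  have hlim := (hasDerivAt_iff_tendsto_slope.1 hFd).mono_left
    (nhdsWithin_mono 0 (s := Ioi 0) fun x (hx : 0 < x) => hx.ne')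
  have hge := ge_of_tendsto hlim (b := 0) (by
    filter_upwards [self_mem_nhdsWithin] with h hh
    rw [slope_def_field, hF0, sub_zero, sub_zero]
    exact div_nonneg (hFpos h hh) (le_of_lt hh))
  rw [← hΦ0]
  have hYT : Y T = ‖P T‖ ^ 2 := by simp [hYdef]
  have hY0 : Y 0 = ‖P 0‖ ^ 2 := by simp [hYdef]
  linarith

end Energy

/-! ### Sobolev inequalities and the convection term in `L²(ℝ)` -/

theorem L2.inner_eq_integral_mul (u v : L2) : inner ℝ u v = ∫ x, u x * v x := by
  rw [L2.inner_def]
  exact integral_congr_ae (ae_of_all _ fun x => mul_comm _ _)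

theorem L2.integrable_mul (u v : L2) : Integrable (fun x => u x * v x) :=
  (Lp.memLp u).integrable_mul (Lp.memLp v)

theorem L2.integrable_abs_mul_abs (u v : L2) : Integrable (fun x => |u x| * |v x|) :=
  (L2.integrable_mul u v).norm.congr (ae_of_all _ fun x => by simp)

theorem L2.integral_abs_mul_abs_le (u v : L2) : ∫ x, |u x| * |v x| ≤ ‖u‖ * ‖v‖ := by
  have h : inner ℝ |u| |v| = ∫ x, |u x| * |v x| := by
    rw [L2.inner_eq_integral_mul]
    refine integral_congr_ae ?_
    filter_upwards [Lp.coeFn_abs u, Lp.coeFn_abs v] with x h1 h2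
    rw [h1, h2]
  rw [← h, ← norm_abs_eq_norm u, ← norm_abs_eq_norm v]
  exact real_inner_le_norm _ _

namespace HasWeakDeriv

variable {u u' u'' v v' : L2}

theorem inner_left (hu : HasWeakDeriv u u') (hv : HasWeakDeriv v v') :
    inner ℝ u' v = -inner ℝ u v' := by
  obtain ⟨w, hw, hwp⟩ := hu.exists_isPrimitive
  obtain ⟨z, hz, hzp⟩ := hv.exists_isPrimitive
  have e1 : (fun x => u' x * v x) =ᵐ[volume] fun x => u' x * z x := by
    filter_upwards [hz] with x h2 using by rw [h2]
  have e2 : (fun x => u x * v' x) =ᵐ[volume] fun x => w x * v' x := by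
    filter_upwards [hw] with x h2 using by rw [h2]
  have e3 : (fun x => u x * v x) =ᵐ[volume] fun x => w x * z x := by
    filter_upwards [hw, hz] with x h1 h2 using by rw [h1, h2]
  have i1 := (L2.integrable_mul u' v).congr e1
  have i2 := (L2.integrable_mul u v').congr e2
  have h := (hwp.mul hzp).integral_eq_zero ((L2.integrable_mul u v).congr e3) (i1.add i2)
  rw [integral_add i1 i2] at h
  rw [L2.inner_eq_integral_mul, L2.inner_eq_integral_mul, integral_congr_ae e1,
    integral_congr_ae e2]
  linarith

theorem inner_self_eq_zero (hu : HasWeakDeriv u u') : inner ℝ u u' = 0 := by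
  have h := hu.inner_left hu
  rw [real_inner_comm] at h
  linarith

/-- Interpolation of the first derivative between a function and its second derivative. -/
theorem norm_sq_le (hu : HasWeakDeriv u u') (hu' : HasWeakDeriv u' u'') :
    ‖u'‖ ^ 2 ≤ ‖u‖ * ‖u''‖ := by
  rw [← real_inner_self_eq_norm_sq, hu.inner_left hu', ← inner_neg_left, ← norm_neg u]
  exact real_inner_le_norm _ _

/-- Agmon's inequality. -/
theorem ae_abs_le (hu : HasWeakDeriv u u') : ∀ᵐ x, |u x| ≤ √(2 * (‖u‖ * ‖u'‖)) := by
  obtain ⟨w, hw, hwp⟩ := hu.exists_isPrimitive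
  have e1 : (fun x => u' x * u x + u x * u' x) =ᵐ[volume]
      fun x => u' x * w x + w x * u' x := by
    filter_upwards [hw] with x h2 using by rw [h2]
  have e3 : (fun x => u x * u x) =ᵐ[volume] fun x => w x * w x := by
    filter_upwards [hw] with x h1 using by rw [h1]
  have i1 := (L2.integrable_mul u' u).add (L2.integrable_mul u u')
  have h := (hwp.mul hwp).eq_integral_Iic ((L2.integrable_mul u u).congr e3) (i1.congr e1)
  filter_upwards [hw] with x hx
  refine Real.abs_le_sqrt ?_
  rw [sq, hx, h x, ← integral_congr_ae (ae_restrict_of_ae e1)]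
  have i2 := L2.integrable_abs_mul_abs u u'
  calc ∫ y in Iic x, (u' y * u y + u y * u' y)
      ≤ ∫ y in Iic x, 2 * (|u y| * |u' y|) := by
        refine integral_mono_ae i1.integrableOn (i2.const_mul 2).integrableOn
          (ae_of_all _ fun y => ?_)
        have h1 := le_abs_self (u y * u' y)
        rw [abs_mul] at h1
        simp only
        linarith [mul_comm (u' y) (u y)]
    _ ≤ ∫ y, 2 * (|u y| * |u' y|) :=
        setIntegral_le_integral (i2.const_mul 2) (ae_of_all _ fun y => by positivity)
    _ ≤ 2 * (‖u‖ * ‖u'‖) := by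
        rw [integral_const_mul]
        exact mul_le_mul_of_nonneg_left (L2.integral_abs_mul_abs_le u u') (by norm_num)

theorem exists_isPrimitive_ae_eq (hu : HasWeakDeriv u u') {w' : ℝ → ℝ} (h : u' =ᵐ[volume] w') :
    ∃ w : ℝ → ℝ, u =ᵐ[volume] w ∧ IsPrimitive w w' := by
  obtain ⟨w, hw, hwp⟩ := hu.exists_isPrimitive
  exact ⟨w, hw, hwp.congr h⟩

end HasWeakDeriv

theorem exists_abs_le_of_continuous {g : ℝ → ℝ} (hg : Continuous g) (c R : ℝ) :
    ∃ M, 0 ≤ M ∧ ∀ r, |r| ≤ R → |g (r + c)| ≤ M := by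
  have hgc : Continuous fun r => g (r + c) := hg.comp (continuous_id.add continuous_const)
  obtain ⟨M, hM⟩ := isCompact_Icc.exists_bound_of_continuousOn (s := Icc (-R) R) hgc.continuousOn
  exact ⟨max M 0, le_max_right _ _, fun r hr => (hM r (abs_le.1 hr)).trans (le_max_left _ _)⟩

theorem aestronglyMeasurable_comp_add_const {g : ℝ → ℝ} (hg : Continuous g) (c : ℝ) (u : L2) :
    AEStronglyMeasurable (fun x => g (u x + c)) volume :=
  hg.comp_aestronglyMeasurable ((Lp.aestronglyMeasurable u).add aestronglyMeasurable_const)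

theorem memLp_comp_mul {g : ℝ → ℝ} (hg : Continuous g) (c : ℝ) {u : L2} {R : ℝ}
    (hu : ∀ᵐ x, |u x| ≤ R) (v : L2) : MemLp (fun x => g (u x + c) * v x) 2 volume := by
  obtain ⟨M, _, hM⟩ := exists_abs_le_of_continuous hg c R
  refine (Lp.memLp v).of_le_mul (c := M)
    ((aestronglyMeasurable_comp_add_const hg c u).mul (Lp.aestronglyMeasurable v)) ?_
  filter_upwards [hu] with x hx
  rw [norm_mul]
  exact mul_le_mul_of_nonneg_right (hM _ hx) (norm_nonneg _)

namespace HasWeakDeriv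

variable {u u' : L2}

/-- The chain rule in weak form. -/
theorem integral_comp_mul_deriv (hu : HasWeakDeriv u u') {f : ℝ → ℝ} (hf : ContDiff ℝ 1 f) (c : ℝ)
    {φ : ℝ → ℝ} (hφ : IsTest φ) :
    ∫ x, f (u x + c) * deriv φ x = -∫ x, deriv f (u x + c) * u' x * φ x := by
  obtain ⟨w, hw, hwp⟩ := hu.exists_isPrimitive
  have hfc : ContDiff ℝ 1 fun r => f (r + c) := hf.comp (contDiff_id.add contDiff_const)
  have hp := (hwp.comp hfc).mul (IsPrimitive.of_contDiff (hφ.1.of_le (by simp)))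
  simp only [deriv_comp_add_const] at hp
  have e1 : (fun x => deriv f (u x + c) * u' x * φ x) =ᵐ[volume]
      fun x => deriv f (w x + c) * u' x * φ x := by
    filter_upwards [hw] with x h2 using by rw [h2]
  have e2 : (fun x => f (u x + c) * deriv φ x) =ᵐ[volume] fun x => f (w x + c) * deriv φ x := by
    filter_upwards [hw] with x h2 using by rw [h2]
  have hfw : Continuous fun x => f (w x + c) := hfc.continuous.comp hwp.continuous
  have i1 := ((memLp_comp_mul (hf.continuous_deriv le_rfl) c hu.ae_abs_le u').integrable_mul
    hφ.memLp).congr e1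
  have i2 : Integrable fun x => f (w x + c) * deriv φ x :=
    (hfw.mul hφ.deriv.1.continuous).integrable_of_hasCompactSupport hφ.deriv.2.mul_left
  have h := hp.integral_eq_zero
    ((hfw.mul hφ.1.continuous).integrable_of_hasCompactSupport hφ.2.mul_left) (i1.add i2)
  rw [integral_add i1 i2] at h
  rw [integral_congr_ae e1, integral_congr_ae e2]
  linarith

/-- The convection term does not contribute to the `L²` balance: `g(u + c) u u'` is the derivative
of `Q(u)`, where `Q` is the primitive of `r ↦ r g(r + c)` that vanishes at `0`, and
`Q(u) = O(u²)` is integrable. -/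
theorem integral_comp_mul_mul_self (hu : HasWeakDeriv u u') {g : ℝ → ℝ} (hg : Continuous g)
    (c : ℝ) : ∫ x, g (u x + c) * u' x * u x = 0 := by
  obtain ⟨w, hw, hwp⟩ := hu.exists_isPrimitive
  have hk : Continuous fun r => r * g (r + c) :=
    continuous_id.mul (hg.comp (continuous_id.add continuous_const))
  set Q : ℝ → ℝ := fun a => ∫ r in (0:ℝ)..a, r * g (r + c) with hQ
  have hQd : ∀ a, HasDerivAt Q (a * g (a + c)) a := fun a =>
    intervalIntegral.integral_hasDerivAt_right (hk.intervalIntegrable _ _)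
      hk.stronglyMeasurable.stronglyMeasurableAtFilter hk.continuousAt
  have hQ' : deriv Q = fun a => a * g (a + c) := funext fun a => (hQd a).deriv
  have hQ1 : ContDiff ℝ 1 Q := contDiff_one_iff_deriv.2
    ⟨fun a => (hQd a).differentiableAt, by rw [hQ']; exact hk⟩
  obtain ⟨M, hM0, hM⟩ := exists_abs_le_of_continuous hg c √(2 * (‖u‖ * ‖u'‖))
  have hint : Integrable fun x => Q (w x) := by
    refine ((L2.integrable_mul u u).const_mul M).mono'
      (hQ1.continuous.comp hwp.continuous).aestronglyMeasurable ?_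
    filter_upwards [hw, hu.ae_abs_le] with x hx hb
    rw [hx] at hb ⊢
    have h1 : ‖Q (w x)‖ ≤ |w x| * M * |w x - 0| := by
      refine intervalIntegral.norm_integral_le_of_norm_le_const fun r hr => ?_
      have hrw : |r| ≤ |w x| := by
        rcases mem_uIoc.1 hr with h | h
        · rw [abs_of_pos h.1, abs_of_pos (h.1.trans_le h.2)]; exact h.2
        · rw [abs_of_nonpos h.2, abs_of_neg (h.1.trans_le h.2)]; linarith [h.1]
      rw [norm_mul]
      exact mul_le_mul hrw (hM r (hrw.trans hb)) (norm_nonneg _) (abs_nonneg _)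
    refine h1.trans (le_of_eq ?_)
    rw [sub_zero, ← abs_mul_abs_self (w x)]
    ring
  have e1 : (fun x => g (u x + c) * u' x * u x) =ᵐ[volume] fun x => deriv Q (w x) * u' x := by
    filter_upwards [hw] with x h2
    rw [h2, hQ']
    ring
  rw [integral_congr_ae e1]
  refine (hwp.comp hQ1).integral_eq_zero hint (Integrable.congr ?_ e1)
  exact (memLp_comp_mul hg c hu.ae_abs_le u').integrable_mul (Lp.memLp u)

/-- The convection term in the balance of second derivatives. One integration by parts removes the
fourth derivative, and the constant part `g c` of the coefficient drops out because
`∫ u' u'''' = 0`. -/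
theorem abs_integral_comp_mul_mul_le {p₀ p₁ p₂ p₃ p₄ : L2} (h₀ : HasWeakDeriv p₀ p₁)
    (h₁ : HasWeakDeriv p₁ p₂) (h₂ : HasWeakDeriv p₂ p₃) (h₃ : HasWeakDeriv p₃ p₄)
    {g : ℝ → ℝ} (hg : ContDiff ℝ 1 g) (c : ℝ) {α β γ : ℝ} (hβ0 : 0 ≤ β)
    (hα : ∀ᵐ x, |g (p₀ x + c) - g c| ≤ α)
    (hβ : ∀ᵐ x, |deriv g (p₀ x + c)| ≤ β) (hγ : ∀ᵐ x, |p₁ x| ≤ γ) :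
    |∫ x, g (p₀ x + c) * p₁ x * p₄ x| ≤ β * γ * (‖p₁‖ * ‖p₃‖) + α * (‖p₂‖ * ‖p₃‖) := by
  obtain ⟨w₃, e₃, k₃⟩ := h₃.exists_isPrimitive
  obtain ⟨w₁, e₁, k₁⟩ := h₁.exists_isPrimitive
  obtain ⟨w₀, e₀, k₀⟩ := h₀.exists_isPrimitive_ae_eq e₁
  have hh : ContDiff ℝ 1 fun r => g (r + c) - g c :=
    (hg.comp (contDiff_id.add contDiff_const)).sub contDiff_const
  have hhc : Continuous fun r => g r - g c := hg.continuous.sub continuous_const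
  have hd : ∀ r, deriv (fun r => g (r + c) - g c) r = deriv g (r + c) := fun r => by
    rw [deriv_sub_const, deriv_comp_add_const]
  have hp := ((k₀.comp hh).mul k₁).mul k₃
  simp only [hd] at hp
  -- the three terms of the derivative of `(g(p₀ + c) - g(c)) p₁ p₃`
  set F₁ : ℝ → ℝ := fun x => deriv g (p₀ x + c) * p₁ x * p₁ x * p₃ x
  set F₂ : ℝ → ℝ := fun x => (g (p₀ x + c) - g c) * p₂ x * p₃ x
  set F₃ : ℝ → ℝ := fun x => (g (p₀ x + c) - g c) * p₁ x * p₄ x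
  have m (v : L2) : MemLp (fun x => (g (p₀ x + c) - g c) * v x) 2 volume :=
    memLp_comp_mul hhc c h₀.ae_abs_le v
  have b₁ : ∀ᵐ x, ‖F₁ x‖ ≤ β * γ * (|p₁ x| * |p₃ x|) := by
    filter_upwards [hβ, hγ] with x h1 h2
    simp only [F₁, norm_mul, Real.norm_eq_abs]
    calc |deriv g (p₀ x + c)| * |p₁ x| * |p₁ x| * |p₃ x| ≤ β * γ * |p₁ x| * |p₃ x| := by gcongr
      _ = _ := by ring
  have b₂ : ∀ᵐ x, ‖F₂ x‖ ≤ α * (|p₂ x| * |p₃ x|) := by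
    filter_upwards [hα] with x h1
    simp only [F₂, norm_mul, Real.norm_eq_abs]
    rw [mul_assoc]
    exact mul_le_mul_of_nonneg_right h1 (by positivity)
  have i₁ : Integrable F₁ := by
    refine ((L2.integrable_abs_mul_abs p₁ p₃).const_mul (β * γ)).mono' ?_ b₁
    exact (((aestronglyMeasurable_comp_add_const (hg.continuous_deriv le_rfl) c p₀).mul
      (Lp.aestronglyMeasurable p₁)).mul (Lp.aestronglyMeasurable p₁)).mul
      (Lp.aestronglyMeasurable p₃)
  have i₂ : Integrable F₂ := (m p₂).integrable_mul (Lp.memLp p₃)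
  have i₃ : Integrable F₃ := (m p₁).integrable_mul (Lp.memLp p₄)
  have i₁₂ : Integrable fun x => F₁ x + F₂ x := i₁.add i₂
  have hzero : ∫ x, (F₁ x + F₂ x + F₃ x) = 0 := by
    have i₀ : Integrable fun x => (g (p₀ x + c) - g c) * p₁ x * p₃ x :=
      (m p₁).integrable_mul (Lp.memLp p₃)
    have e : (fun x => F₁ x + F₂ x + F₃ x) =ᵐ[volume] fun x =>
        (deriv g (w₀ x + c) * w₁ x * w₁ x + (g (w₀ x + c) - g c) * p₂ x) * w₃ x +
          (g (w₀ x + c) - g c) * w₁ x * p₄ x := by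
      filter_upwards [e₀, e₁, e₃] with x a0 a1 a3
      simp only [F₁, F₂, F₃, a0, a1, a3]
      ring
    rw [integral_congr_ae e]
    refine hp.integral_eq_zero (i₀.congr ?_) ((i₁₂.add i₃).congr e)
    filter_upwards [e₀, e₁, e₃] with x a0 a1 a3
    rw [a0, a1, a3]
  rw [integral_add i₁₂ i₃, integral_add i₁ i₂] at hzero
  have hlin : ∫ x, g (p₀ x + c) * p₁ x * p₄ x = ∫ x, F₃ x := by
    have h4 : ∫ x, p₁ x * p₄ x = 0 := by
      rw [← L2.inner_eq_integral_mul]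
      have h5 := h₁.inner_left h₃
      rw [h₂.inner_self_eq_zero] at h5
      linarith
    have h6 : ∀ x, g (p₀ x + c) * p₁ x * p₄ x = F₃ x + g c * (p₁ x * p₄ x) := fun x => by
      simp only [F₃]
      ring
    simp only [h6]
    rw [integral_add i₃ ((L2.integrable_mul p₁ p₄).const_mul _), integral_const_mul, h4,
      mul_zero, add_zero]
  have hα0 : 0 ≤ α := by
    obtain ⟨x, hx⟩ := hα.exists
    exact (abs_nonneg _).trans hx
  have hγ0 : 0 ≤ γ := by
    obtain ⟨x, hx⟩ := hγ.exists
    exact (abs_nonneg _).trans hx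
  have B₁ : |∫ x, F₁ x| ≤ β * γ * (‖p₁‖ * ‖p₃‖) := by
    refine (norm_integral_le_of_norm_le
      ((L2.integrable_abs_mul_abs p₁ p₃).const_mul (β * γ)) b₁).trans ?_
    rw [integral_const_mul]
    exact mul_le_mul_of_nonneg_left (L2.integral_abs_mul_abs_le _ _) (by positivity)
  have B₂ : |∫ x, F₂ x| ≤ α * (‖p₂‖ * ‖p₃‖) := by
    refine (norm_integral_le_of_norm_le ((L2.integrable_abs_mul_abs p₂ p₃).const_mul α) b₂).trans ?_
    rw [integral_const_mul]
    exact mul_le_mul_of_nonneg_left (L2.integral_abs_mul_abs_le _ _) hα0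
  have h7 : ∫ x, F₃ x = -((∫ x, F₁ x) + ∫ x, F₂ x) := by linarith
  rw [hlin, h7, abs_neg]
  exact (abs_add_le _ _).trans (add_le_add B₁ B₂)

end HasWeakDeriv

/-! ### The time derivative of a solution -/

theorem hasWeakDeriv_dx_zero (u : H 2) : HasWeakDeriv (dx 0 u) (dx 1 u) := u.2 0

theorem hasWeakDeriv_dx_one (u : H 2) : HasWeakDeriv (dx 1 u) (dx 2 u) := u.2 1

theorem H.norm_sq_eq (u : H 2) : ‖u‖ ^ 2 = ‖dx 0 u‖ ^ 2 + ‖dx 1 u‖ ^ 2 + ‖dx 2 u‖ ^ 2 := by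
  rw [Submodule.coe_norm, PiLp.norm_sq_eq_of_L2, Fin.sum_univ_three]
  rfl

theorem H.norm_dx_le (j : Fin 3) (u : H 2) : ‖dx j u‖ ≤ ‖u‖ :=
  PiLp.norm_apply_le (p := 2) (u : PiLp 2 (fun _ : Fin 3 => L2)) j

theorem H.dx_sub (j : Fin 3) (u v : H 2) : dx j (u - v) = dx j u - dx j v := rfl

theorem H.continuous_dx (j : Fin 3) : Continuous (dx j : H 2 → L2) :=
  (PiLp.continuous_apply 2 _ j).comp continuous_subtype_val

theorem H.ae_abs_dx_zero_le (u : H 2) : ∀ᵐ x, |dx 0 u x| ≤ 2 * ‖u‖ := by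
  filter_upwards [(hasWeakDeriv_dx_zero u).ae_abs_le] with x hx
  refine hx.trans (Real.sqrt_le_iff.2 ⟨by positivity, ?_⟩)
  have h := mul_le_mul (H.norm_dx_le 0 u) (H.norm_dx_le 1 u) (norm_nonneg _) (norm_nonneg _)
  nlinarith [sq_nonneg ‖u‖]

/-- The convection term `g(u + c) ∂ₓu ∈ L²(ℝ)` for `u ∈ H²(ℝ)`. -/
def convection {g : ℝ → ℝ} (hg : Continuous g) (c : ℝ) (u : H 2) : L2 :=
  (memLp_comp_mul hg c (hasWeakDeriv_dx_zero u).ae_abs_le (dx 1 u)).toLp _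

section Convection

variable {g : ℝ → ℝ} (hg : Continuous g) (c : ℝ)

theorem coeFn_convection (u : H 2) :
    convection hg c u =ᵐ[volume] fun x => g (dx 0 u x + c) * dx 1 u x :=
  MemLp.coeFn_toLp _

theorem integral_convection_mul (u : H 2) (φ : ℝ → ℝ) :
    ∫ x, convection hg c u x * φ x = ∫ x, g (dx 0 u x + c) * dx 1 u x * φ x := by
  refine integral_congr_ae ?_
  filter_upwards [coeFn_convection hg c u] with x hx using by rw [hx]

theorem exists_norm_convection_sub_le (hg1 : ContDiff ℝ 1 g) (R : ℝ) :
    ∃ L : ℝ, ∀ u v : H 2, ‖u‖ ≤ R → ‖v‖ ≤ R →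
      ‖convection hg c u - convection hg c v‖ ≤ L * ‖u - v‖ := by
  obtain ⟨M, hM0, hM⟩ := exists_abs_le_of_continuous hg c (2 * R)
  obtain ⟨K, hK⟩ := hg1.contDiffOn.exists_lipschitzOnWith (by decide)
    (convex_Icc (-(2 * R) + c) (2 * R + c)) isCompact_Icc
  refine ⟨2 * K * R + M, fun u v hu hv => ?_⟩
  have hmem : ∀ r, |r| ≤ 2 * R → r + c ∈ Icc (-(2 * R) + c) (2 * R + c) := fun r hr =>
    ⟨by linarith [(abs_le.1 hr).1], by linarith [(abs_le.1 hr).2]⟩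
  have hle : ‖convection hg c u - convection hg c v‖ ≤
      ‖(2 * K * ‖u - v‖) • |dx 1 u| + M • |dx 1 (u - v)|‖ := by
    refine Lp.norm_le_norm_of_ae_le ?_
    filter_upwards [Lp.coeFn_sub (convection hg c u) (convection hg c v), coeFn_convection hg c u,
      coeFn_convection hg c v, Lp.coeFn_add ((2 * K * ‖u - v‖) • |dx 1 u|) (M • |dx 1 (u - v)|),
      Lp.coeFn_smul (2 * K * ‖u - v‖) |dx 1 u|, Lp.coeFn_smul M |dx 1 (u - v)|,
      Lp.coeFn_abs (dx 1 u), Lp.coeFn_abs (dx 1 (u - v)), H.ae_abs_dx_zero_le u,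
      H.ae_abs_dx_zero_le v, H.ae_abs_dx_zero_le (u - v), Lp.coeFn_sub (dx 1 u) (dx 1 v),
      Lp.coeFn_sub (dx 0 u) (dx 0 v)] with x h1 h2 h3 h4 h5 h6 h7 h8 h9 h10 h11 h12 h13
    rw [H.dx_sub] at h11
    rw [h13] at h11
    rw [h1, Pi.sub_apply, h2, h3, h4, Pi.add_apply, h5, h6, Pi.smul_apply, Pi.smul_apply, h7, h8,
      H.dx_sub, h12, smul_eq_mul, smul_eq_mul]
    simp only [Pi.sub_apply] at h11 ⊢
    set a := dx 0 u x
    set b := dx 0 v x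
    set p := dx 1 u x
    set r := dx 1 v x
    have e : g (a + c) * p - g (b + c) * r =
        (g (a + c) - g (b + c)) * p + g (b + c) * (p - r) := by ring
    have ha : |a| ≤ 2 * R := h9.trans (by linarith)
    have hb : |b| ≤ 2 * R := h10.trans (by linarith)
    have hlip : |g (a + c) - g (b + c)| ≤ 2 * K * ‖u - v‖ := by
      have h := hK.dist_le_mul _ (hmem a ha) _ (hmem b hb)
      rw [Real.dist_eq, Real.dist_eq, add_sub_add_right_eq_sub] at h
      refine h.trans ?_
      have := mul_le_mul_of_nonneg_left h11 K.2
      simp only [NNReal.val_eq_coe] at this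
      linarith
    rw [e, Real.norm_eq_abs, Real.norm_eq_abs]
    have hpos : 0 ≤ 2 * K * ‖u - v‖ * |p| + M * |p - r| := by positivity
    rw [abs_of_nonneg hpos]
    refine (abs_add_le _ _).trans (add_le_add ?_ ?_)
    · rw [abs_mul]
      exact mul_le_mul_of_nonneg_right hlip (abs_nonneg _)
    · rw [abs_mul]
      exact mul_le_mul_of_nonneg_right (hM b hb) (abs_nonneg _)
  refine hle.trans ((norm_add_le _ _).trans ?_)
  rw [norm_smul, norm_smul, norm_abs_eq_norm, norm_abs_eq_norm, Real.norm_of_nonneg hM0,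
    Real.norm_of_nonneg (by positivity)]
  have h1 := (H.norm_dx_le 1 u).trans hu
  have h2 := H.norm_dx_le 1 (u - v)
  calc 2 * K * ‖u - v‖ * ‖dx 1 u‖ + M * ‖dx 1 (u - v)‖
      ≤ 2 * K * ‖u - v‖ * R + M * ‖u - v‖ := by gcongr
    _ = (2 * K * R + M) * ‖u - v‖ := by ring

/-- Continuity of the convection term on `H²(ℝ)` makes it measurable and bounded in time along a
solution. -/
theorem continuous_convection (hg1 : ContDiff ℝ 1 g) : Continuous (convection hg c) := by
  rw [continuous_iff_continuousAt]
  intro u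
  obtain ⟨L, hL⟩ := exists_norm_convection_sub_le hg c hg1 (‖u‖ + 1)
  rw [ContinuousAt, tendsto_iff_norm_sub_tendsto_zero]
  have h0 : Tendsto (fun v => L * ‖v - u‖) (𝓝 u) (𝓝 0) := by
    have := (tendsto_iff_norm_sub_tendsto_zero.1 (tendsto_id (x := 𝓝 u))).const_mul L
    simpa using this
  refine squeeze_zero' (Eventually.of_forall fun _ => norm_nonneg _) ?_ h0
  filter_upwards [Metric.ball_mem_nhds u one_pos] with v hv
  refine hL v u ?_ (by linarith)
  rw [mem_ball_iff_norm] at hv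
  have := norm_sub_norm_le v u
  linarith

end Convection

theorem HasWeakDeriv.integral_mul_deriv_deriv {u u' u'' : L2} (h : HasWeakDeriv u u')
    (h' : HasWeakDeriv u' u'') {φ : ℝ → ℝ} (hφ : IsTest φ) :
    ∫ x, u x * deriv (deriv φ) x = ∫ x, u'' x * φ x := by
  rw [h _ hφ.deriv, h' _ hφ, neg_neg]

theorem contDiff_deriv {f : ℝ → ℝ} (hf : ContDiff ℝ 2 f) : ContDiff ℝ 1 (deriv f) :=
  (contDiff_succ_iff_deriv.1 (by simpa [one_add_one_eq_two] using hf : ContDiff ℝ (1 + 1) f)).2.2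

theorem memLp_of_continuousOn {E : Type*} [NormedAddCommGroup E] {F : ℝ → E} {T : ℝ}
    (hF : ContinuousOn F (Icc 0 T)) : MemLp F 2 (volume.restrict (Ioo 0 T)) := by
  obtain ⟨C, hC⟩ := isCompact_Icc.exists_bound_of_continuousOn hF
  refine MemLp.of_bound ((hF.mono Ioo_subset_Icc_self).aestronglyMeasurable measurableSet_Ioo) C ?_
  filter_upwards [ae_restrict_mem measurableSet_Ioo] with t ht using hC t ⟨ht.1.le, ht.2.le⟩

namespace IsSolution

variable {f : ℝ → ℝ} {c δ ν : ℝ} {ψ₀ : H 2} {T : ℝ} {ψ χ : ℝ → H 2}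

/-- The time derivative `-∂ₓ(f(ψ + ũ)) - δ ∂ₓ³ψ - ν ∂ₓ⁴ψ ∈ L²(0,T; L²)` of a solution. The third
and fourth derivatives of `ψ` are the first and second derivatives of `χ = ∂ₓ²ψ`. -/
def timeDeriv (hf : ContDiff ℝ 2 f) (c δ ν : ℝ) (ψ χ : ℝ → H 2) (t : ℝ) : L2 :=
  -(convection (hf.continuous_deriv (by norm_num)) c (ψ t) + δ • dx 1 (χ t) + ν • dx 2 (χ t))

variable (hf : ContDiff ℝ 2 f)

theorem memLp_dx_χ (h : IsSolution f c δ ν ψ₀ T ψ χ) (j : Fin 3) :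
    MemLp (fun t => dx j (χ t)) 2 (volume.restrict (Ioo 0 T)) :=
  h.memLp.of_le ((H.continuous_dx j).comp_aestronglyMeasurable h.memLp.aestronglyMeasurable)
    (ae_of_all _ fun t => H.norm_dx_le j (χ t))

theorem memLp_timeDeriv (h : IsSolution f c δ ν ψ₀ T ψ χ) :
    MemLp (timeDeriv hf c δ ν ψ χ) 2 (volume.restrict (Ioo 0 T)) :=
  (((memLp_of_continuousOn ((continuous_convection _ c (contDiff_deriv hf)).comp_continuousOn
    h.continuousOn)).add ((h.memLp_dx_χ 1).const_smul δ)).add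
      ((h.memLp_dx_χ 2).const_smul ν)).neg

/-- The weak formulation tested with `φ` is the pairing of this identity in `L²(ℝ)` with `φ`. -/
theorem sub_eq_integral_timeDeriv (h : IsSolution f c δ ν ψ₀ T ψ χ) {t : ℝ} (ht : t ∈ Icc 0 T) :
    dx 0 (ψ t) - dx 0 (ψ 0) = ∫ s in (0 : ℝ)..t, timeDeriv hf c δ ν ψ χ s := by
  have loc (u : L2) : LocallyIntegrable u := (Lp.memLp u).locallyIntegrable (by norm_num)
  set I := ∫ s in (0 : ℝ)..t, timeDeriv hf c δ ν ψ χ s with hI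
  refine Lp.ext (ae_eq_of_integral_contDiff_smul_eq (loc _) (loc _) fun φ hφ1 hφ2 => ?_)
  have hφ : IsTest φ := ⟨hφ1, hφ2⟩
  have hin (u : L2) : ∫ x, φ x • u x = inner ℝ (hφ.memLp.toLp φ) u := by
    rw [L2.inner_eq_integral_mul]
    refine integral_congr_ae ?_
    filter_upwards [hφ.memLp.coeFn_toLp] with x hx
    rw [hx, smul_eq_mul]
  have hin' (u : L2) : ∫ x, u x * φ x = inner ℝ (hφ.memLp.toLp φ) u := by
    rw [← hin]
    exact integral_congr_ae (ae_of_all _ fun x => mul_comm _ _)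
  rw [hin, hin, inner_sub_right, ← hin', ← hin', h.equation φ hφ t ht, hI]
  have hint : IntervalIntegrable (timeDeriv hf c δ ν ψ χ) volume 0 t := by
    rw [intervalIntegrable_iff_integrableOn_Ioo_of_le ht.1]
    exact IntegrableOn.mono_set ((h.memLp_timeDeriv hf).integrable (by norm_num))
      (Ioo_subset_Ioo_right ht.2)
  have hcomm := (innerSL ℝ (hφ.memLp.toLp φ)).intervalIntegral_comp_comm hint
  simp only [innerSL_apply_apply] at hcomm
  rw [← hcomm, intervalIntegral.integral_of_le ht.1, intervalIntegral.integral_of_le ht.1,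
    integral_Ioc_eq_integral_Ioo, integral_Ioc_eq_integral_Ioo]
  refine integral_congr_ae ?_
  filter_upwards [ae_restrict_of_ae_restrict_of_subset (Ioo_subset_Ioo_right ht.2) h.dxx_eq]
    with s hs
  have k0 := hasWeakDeriv_dx_zero (ψ s)
  have k1 := hasWeakDeriv_dx_one (ψ s)
  have k2 := hasWeakDeriv_dx_zero (χ s)
  have k3 := hasWeakDeriv_dx_one (χ s)
  rw [hs] at k2
  have e3 : ∫ x, dx 0 (ψ s) x * iteratedDeriv 3 φ x = -∫ x, dx 1 (χ s) x * φ x := by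
    simp only [iteratedDeriv_succ, iteratedDeriv_zero]
    rw [k0.integral_mul_deriv_deriv k1 hφ.deriv, k2 φ hφ]
  have e4 : ∫ x, dx 0 (ψ s) x * iteratedDeriv 4 φ x = ∫ x, dx 2 (χ s) x * φ x := by
    simp only [iteratedDeriv_succ, iteratedDeriv_zero]
    rw [k0.integral_mul_deriv_deriv k1 hφ.deriv.deriv, k2.integral_mul_deriv_deriv k3 hφ]
  rw [e3, e4, k0.integral_comp_mul_deriv (hf.of_le (by norm_num)) c hφ,
    ← integral_convection_mul (hf.continuous_deriv (by norm_num)), hin', hin', hin', timeDeriv,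
    inner_neg_right, inner_add_right, inner_add_right, inner_smul_right, inner_smul_right]
  ring

end IsSolution

/-! ### Estimates of the convection term, and a Grönwall inequality -/

/-- The growth condition recentred at `c`, for `f''` and for the increments of `f'`. -/
theorem exists_growth_bound {f : ℝ → ℝ} (hf : ContDiff ℝ 2 f) {q : ℝ} (hq0 : 0 ≤ q) (hq5 : q ≤ 5)
    (hgrowth : ∃ K : ℝ, ∀ u : ℝ, |iteratedDeriv 2 f u| ≤ K * (1 + |u| ^ q)) (c : ℝ) :
    ∃ K : ℝ, 0 ≤ K ∧ ∀ r : ℝ, |deriv (deriv f) (r + c)| ≤ K * (1 + |r| ^ 5) ∧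
      |deriv f (r + c) - deriv f c| ≤ K * (|r| + |r| ^ 6) := by
  obtain ⟨K, hK⟩ := hgrowth
  have hpow : ∀ u : ℝ, |u| ^ q ≤ 1 + |u| ^ 5 := by
    intro u
    rcases le_total |u| 1 with h | h
    · exact (Real.rpow_le_one (abs_nonneg u) h hq0).trans
        (by linarith [pow_nonneg (abs_nonneg u) 5])
    · have := Real.rpow_le_rpow_of_exponent_le h hq5
      rw [show (5 : ℝ) = ((5 : ℕ) : ℝ) by norm_num, Real.rpow_natCast] at this
      linarith
  have h2 : ∀ r : ℝ, |deriv (deriv f) (r + c)| ≤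
      |K| * (18 + 16 * |c| ^ 5) * (1 + |r| ^ 5) := by
    intro r
    have h3 := hK (r + c)
    simp only [iteratedDeriv_succ, iteratedDeriv_zero] at h3
    have h4 : |r + c| ^ 5 ≤ 16 * (|r| ^ 5 + |c| ^ 5) :=
      (pow_le_pow_left₀ (abs_nonneg _) (abs_add_le r c) 5).trans
        ((add_pow_le (abs_nonneg _) (abs_nonneg _) 5).trans (by norm_num))
    have h5 : 1 + |r + c| ^ q ≤ (18 + 16 * |c| ^ 5) * (1 + |r| ^ 5) := by
      have := hpow (r + c)
      have hr := pow_nonneg (abs_nonneg r) 5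
      have hc := pow_nonneg (abs_nonneg c) 5
      nlinarith [mul_nonneg hr hc]
    calc _ ≤ K * (1 + |r + c| ^ q) := h3
      _ ≤ |K| * (1 + |r + c| ^ q) :=
        mul_le_mul_of_nonneg_right (le_abs_self K) (by positivity)
      _ ≤ |K| * ((18 + 16 * |c| ^ 5) * (1 + |r| ^ 5)) :=
        mul_le_mul_of_nonneg_left h5 (abs_nonneg K)
      _ = _ := by ring
  set K' := |K| * (18 + 16 * |c| ^ 5)
  have hK' : 0 ≤ K' := by positivity
  refine ⟨K', hK', fun r => ⟨h2 r, ?_⟩⟩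
  have hmv := (convex_Icc (-|r| + c) (|r| + c)).norm_image_sub_le_of_norm_deriv_le
    (f := deriv f) (C := K' * (1 + |r| ^ 5)) (x := c) (y := r + c)
    (fun x _ => ((contDiff_deriv hf).differentiable (by simp)) x)
    (fun x hx => ?_) ⟨by linarith [abs_nonneg r], by linarith [abs_nonneg r]⟩
    ⟨by linarith [neg_abs_le r], by linarith [le_abs_self r]⟩
  · rw [Real.norm_eq_abs, add_sub_cancel_right, Real.norm_eq_abs] at hmv
    calc _ ≤ _ := hmv
      _ = _ := by ring
  · have h3 := h2 (x - c)
    rw [sub_add_cancel] at h3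
    refine h3.trans (mul_le_mul_of_nonneg_left ?_ hK')
    have : |x - c| ≤ |r| := abs_le.2 ⟨by linarith [hx.1], by linarith [hx.2]⟩
    gcongr

/-- Young's inequality with exponents `4/3` and `4` and an explicit constant. -/
theorem mul_cube_mul_le {x ζ L ε : ℝ} (hx : 0 ≤ x) (hζ : 0 ≤ ζ) (hL : 0 ≤ L) (hε : 0 < ε) :
    L * (x ^ 3 * ζ) ≤ L * (1 + L / ε) * x ^ 4 + ε * ζ ^ 4 := by
  set l := 1 + L / ε with hl
  have hl1 : 1 ≤ l := by rw [hl]; linarith [div_nonneg hL hε.le]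
  have hLl : L ≤ ε * l := by rw [hl, mul_add, mul_div_cancel₀ _ hε.ne']; linarith
  rcases le_total ζ (l * x) with h | h
  · have h1 : x ^ 3 * ζ ≤ l * x ^ 4 := by
      calc x ^ 3 * ζ ≤ x ^ 3 * (l * x) := by gcongr
        _ = l * x ^ 4 := by ring
    have h2 := mul_le_mul_of_nonneg_left h1 hL
    have h3 : 0 ≤ ε * ζ ^ 4 := by positivity
    linarith
  · have hxz : x ≤ ζ := (le_mul_of_one_le_left hx hl1).trans h
    have h1 : L * (x ^ 3 * ζ) ≤ ε * ζ ^ 4 := by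
      calc L * (x ^ 3 * ζ) ≤ (ε * l) * (x ^ 3 * ζ) := by gcongr
        _ = ε * (x ^ 2 * (l * x) * ζ) := by ring
        _ ≤ ε * (ζ ^ 2 * ζ * ζ) := by gcongr
        _ = ε * ζ ^ 4 := by ring
    have h2 : 0 ≤ L * l * x ^ 4 := by positivity
    linarith

theorem exists_pow_four_eq {S : ℝ} (hS : 0 ≤ S) : ∃ s, 0 ≤ s ∧ s ^ 4 = S :=
  ⟨√√S, Real.sqrt_nonneg _, by
    rw [show √√S ^ 4 = (√√S ^ 2) ^ 2 by ring, Real.sq_sqrt (Real.sqrt_nonneg _), Real.sq_sqrt hS]⟩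

/-- Here and below, norms are measured by the fourth root `s` of the `L²` norm of the second
derivative, which turns the interpolation exponents `1/4`, `1/2`, `3/4` into integers. -/
theorem HasWeakDeriv.norm_le_of_pow_four {u u' u'' : L2} (h : HasWeakDeriv u u')
    (h' : HasWeakDeriv u' u'') {M s : ℝ} (hM : ‖u‖ ≤ M) (hS : s ^ 4 = ‖u''‖) :
    ‖u'‖ ≤ 2 * (1 + M) * s ^ 2 := by
  have hM0 := (norm_nonneg u).trans hM
  refine le_of_sq_le_sq ((h.norm_sq_le h').trans ?_) (by positivity)
  rw [← hS]
  calc ‖u‖ * s ^ 4 ≤ M * s ^ 4 := by gcongr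
    _ ≤ (2 * (1 + M)) ^ 2 * s ^ 4 := by
      gcongr
      nlinarith
    _ = _ := by ring

theorem HasWeakDeriv.ae_abs_le_of_pow_four {u u' u'' : L2} (h : HasWeakDeriv u u')
    (h' : HasWeakDeriv u' u'') {M s : ℝ} (hM : ‖u‖ ≤ M) (hs : 0 ≤ s) (hS : s ^ 4 = ‖u''‖) :
    ∀ᵐ x, |u x| ≤ 2 * (1 + M) * s := by
  have hM0 := (norm_nonneg u).trans hM
  filter_upwards [h.ae_abs_le] with x hx
  refine hx.trans (Real.sqrt_le_iff.2 ⟨by positivity, ?_⟩)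
  have h1 := h.norm_le_of_pow_four h' hM hS
  calc 2 * (‖u‖ * ‖u'‖) ≤ 2 * (M * (2 * (1 + M) * s ^ 2)) := by gcongr
    _ = (2 * M) * (2 * (1 + M)) * s ^ 2 := by ring
    _ ≤ (2 * (1 + M)) * (2 * (1 + M)) * s ^ 2 := by
      gcongr
      linarith
    _ = _ := by ring

theorem HasWeakDeriv.ae_abs_deriv_le_of_pow_four {u u' u'' : L2} (h : HasWeakDeriv u u')
    (h' : HasWeakDeriv u' u'') {M s : ℝ} (hM : ‖u‖ ≤ M) (hs : 0 ≤ s) (hS : s ^ 4 = ‖u''‖) :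
    ∀ᵐ x, |u' x| ≤ 2 * (1 + M) * s ^ 3 := by
  have hM0 := (norm_nonneg u).trans hM
  filter_upwards [h'.ae_abs_le] with x hx
  refine hx.trans (Real.sqrt_le_iff.2 ⟨by positivity, ?_⟩)
  have h1 := h.norm_le_of_pow_four h' hM hS
  rw [← hS]
  calc 2 * (‖u'‖ * s ^ 4) ≤ 2 * (2 * (1 + M) * s ^ 2 * s ^ 4) := by gcongr
    _ = 2 * (2 * (1 + M)) * s ^ 6 := by ring
    _ ≤ (2 * (1 + M)) * (2 * (1 + M)) * s ^ 6 := by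
      gcongr
      linarith
    _ = _ := by ring

/-- The convection term paired with the fourth derivative is bounded by `C (Y + Y²)` with
`Y = ‖p₂‖²`, up to a part that the fourth order diffusion absorbs. The constant depends on `p₀` only
through the bound `M` of its norm. -/
theorem exists_abs_integral_convection_le {g : ℝ → ℝ} (hg : ContDiff ℝ 1 g) (c : ℝ) {K : ℝ}
    (hK : 0 ≤ K) (hgK : ∀ r : ℝ, |deriv g (r + c)| ≤ K * (1 + |r| ^ 5) ∧
      |g (r + c) - g c| ≤ K * (|r| + |r| ^ 6)) {M ν : ℝ} (hM : 0 ≤ M) (hν : 0 < ν) :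
    ∃ C, 0 ≤ C ∧ ∀ p₀ p₁ p₂ p₃ p₄ : L2, HasWeakDeriv p₀ p₁ → HasWeakDeriv p₁ p₂ →
      HasWeakDeriv p₂ p₃ → HasWeakDeriv p₃ p₄ → ‖p₀‖ ≤ M →
      |∫ x, g (p₀ x + c) * p₁ x * p₄ x| ≤
        C * (‖p₂‖ ^ 2 + (‖p₂‖ ^ 2) ^ 2) + ν / 2 * ‖p₄‖ ^ 2 := by
  set D := 2 * (1 + M) with hD
  have hD1 : 1 ≤ D := by rw [hD]; linarith
  have hD0 : 0 ≤ D := zero_le_one.trans hD1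
  set L := 4 * K * D ^ 7 with hLdef
  have hL : 0 ≤ L := by positivity
  refine ⟨L * (1 + L / (ν / 4)), by positivity, fun p₀ p₁ p₂ p₃ p₄ h₀ h₁ h₂ h₃ hp => ?_⟩
  obtain ⟨s, hs, hS⟩ := exists_pow_four_eq (norm_nonneg p₂)
  have hZ := Real.sq_sqrt (norm_nonneg p₄)
  set ζ := √‖p₄‖
  have hζ : 0 ≤ ζ := Real.sqrt_nonneg _
  have hn1 := h₀.norm_le_of_pow_four h₁ hp hS
  have ha0 := h₀.ae_abs_le_of_pow_four h₁ hp hs hS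
  have ha1 := h₀.ae_abs_deriv_le_of_pow_four h₁ hp hs hS
  rw [← hD] at hn1 ha0 ha1
  have hn3 : ‖p₃‖ ≤ s ^ 2 * ζ := by
    refine le_of_sq_le_sq ((h₂.norm_sq_le h₃).trans (le_of_eq ?_)) (by positivity)
    rw [← hS, ← hZ]
    ring
  have key := h₀.abs_integral_comp_mul_mul_le h₁ h₂ h₃ hg c
    (α := K * (D * s + (D * s) ^ 6)) (β := K * (1 + (D * s) ^ 5)) (γ := D * s ^ 3) (by positivity)
    (by filter_upwards [ha0] with x hx
        exact (hgK _).2.trans (by gcongr))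
    (by filter_upwards [ha0] with x hx
        exact (hgK _).1.trans (by gcongr)) ha1
  refine key.trans ?_
  rw [← hS, ← hZ]
  have y1 := mul_cube_mul_le (pow_nonneg hs 2) hζ hL (by positivity : 0 < ν / 4)
  have y2 := mul_cube_mul_le (pow_nonneg hs 4) hζ hL (by positivity : 0 < ν / 4)
  -- reduces `s⁷ ζ` to `s⁶ ζ` and `s¹² ζ`, the cases `x = s²` and `x = s⁴` of `x³ ζ`
  have hs7 : s ^ 7 ≤ s ^ 6 + s ^ 12 := by
    rcases le_total s 1 with h | h
    · have := mul_le_mul_of_nonneg_left h (pow_nonneg hs 6)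
      have := pow_nonneg hs 12
      nlinarith
    · have := pow_le_pow_right₀ h (show 7 ≤ 12 by norm_num)
      have := pow_nonneg hs 6
      linarith
  have d1 : D ≤ D ^ 7 := le_self_pow₀ hD1 (by norm_num)
  have d2 : D ^ 2 ≤ D ^ 7 := pow_le_pow_right₀ hD1 (by norm_num)
  have d6 : D ^ 6 ≤ D ^ 7 := pow_le_pow_right₀ hD1 (by norm_num)
  calc K * (1 + (D * s) ^ 5) * (D * s ^ 3) * (‖p₁‖ * ‖p₃‖) +
        K * (D * s + (D * s) ^ 6) * (s ^ 4 * ‖p₃‖)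
      ≤ K * (1 + (D * s) ^ 5) * (D * s ^ 3) * (D * s ^ 2 * (s ^ 2 * ζ)) +
        K * (D * s + (D * s) ^ 6) * (s ^ 4 * (s ^ 2 * ζ)) := by gcongr
    _ = K * ζ * ((D ^ 2 + D) * s ^ 7 + (D ^ 7 + D ^ 6) * s ^ 12) := by ring
    _ ≤ K * ζ * ((D ^ 7 + D ^ 7) * (s ^ 6 + s ^ 12) + (D ^ 7 + D ^ 7) * (s ^ 6 + s ^ 12)) := by
        gcongr
        linarith [pow_nonneg hs 6]
    _ = L * ((s ^ 2) ^ 3 * ζ) + L * ((s ^ 4) ^ 3 * ζ) := by rw [hLdef]; ring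
    _ ≤ _ := add_le_add y1 y2
    _ = _ := by ring

/-- Grönwall's inequality for `Y ≤ B + k ∫ Y²`, read as a linear inequality with coefficient `Y`. -/
theorem le_mul_exp_of_le_add_integral_sq {Y : ℝ → ℝ} {T B k : ℝ} (hT : 0 ≤ T)
    (hY : ContinuousOn Y (Icc 0 T)) (hY0 : ∀ t ∈ Icc 0 T, 0 ≤ Y t) (hk : 0 ≤ k)
    (h : ∀ t ∈ Icc 0 T, Y t ≤ B + k * ∫ s in (0 : ℝ)..t, Y s ^ 2) :
    Y T ≤ B * Real.exp (k * ∫ s in (0 : ℝ)..T, Y s) := by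
  set X : ℝ → ℝ := fun t => Y (projIcc 0 T hT t) with hX
  have hXY : ∀ t ∈ Icc 0 T, X t = Y t := fun t ht => by simp [hX, projIcc_of_mem hT ht]
  have hXc : Continuous X := hY.comp_continuous (continuous_subtype_val.comp continuous_projIcc)
    fun t => (projIcc 0 T hT t).2
  have hint (k : ℕ) : ∀ t ∈ Icc 0 T, ∫ s in (0:ℝ)..t, Y s ^ k = ∫ s in (0:ℝ)..t, X s ^ k := by
    intro t ht
    refine intervalIntegral.integral_congr fun s hs => ?_
    rw [uIcc_of_le ht.1] at hs
    simp only [hXY s ⟨hs.1, hs.2.trans ht.2⟩]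
  have hd : ∀ {Z : ℝ → ℝ}, Continuous Z → ∀ t,
      HasDerivAt (fun t => ∫ s in (0:ℝ)..t, Z s) (Z t) t := fun hZ t =>
    intervalIntegral.integral_hasDerivAt_right (hZ.intervalIntegrable _ _)
      hZ.stronglyMeasurable.stronglyMeasurableAtFilter hZ.continuousAt
  -- `W = E exp(-k ∫ Y)` with `E = B + k ∫ Y²` is nonincreasing, as `E' = k Y² ≤ k Y E`
  set W : ℝ → ℝ := fun t => (B + k * ∫ s in (0:ℝ)..t, X s ^ 2) *
    Real.exp (-(k * ∫ s in (0:ℝ)..t, X s)) with hW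
  have hWd : ∀ t, HasDerivAt W (k * X t ^ 2 * Real.exp (-(k * ∫ s in (0:ℝ)..t, X s)) +
      (B + k * ∫ s in (0:ℝ)..t, X s ^ 2) *
        (Real.exp (-(k * ∫ s in (0:ℝ)..t, X s)) * -(k * X t))) t := fun t =>
    (((hd (hXc.pow 2) t).const_mul k).const_add B).mul ((hd hXc t).const_mul k).neg.exp
  have hanti : AntitoneOn W (Icc 0 T) := by
    refine antitoneOn_of_deriv_nonpos (convex_Icc 0 T)
      (fun t _ => (hWd t).continuousAt.continuousWithinAt)
      (fun t _ => (hWd t).differentiableAt.differentiableWithinAt) fun t ht => ?_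
    rw [interior_Icc] at ht
    have htm : t ∈ Icc 0 T := ⟨ht.1.le, ht.2.le⟩
    have h1 := h t htm
    rw [hint 2 t htm, ← hXY t htm] at h1
    have h2 := hY0 t htm
    rw [← hXY t htm] at h2
    rw [(hWd t).deriv]
    have h3 : 0 ≤ k * X t * Real.exp (-(k * ∫ s in (0:ℝ)..t, X s)) := by positivity
    have h4 := mul_le_mul_of_nonneg_left h1 h3
    nlinarith
  have hTm : T ∈ Icc 0 T := ⟨hT, le_rfl⟩
  have hWT := hanti ⟨le_rfl, hT⟩ hTm hT
  have hW0 : W 0 = B := by simp [hW]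
  rw [hW0] at hWT
  have h1 := hint 1 T hTm
  simp only [pow_one] at h1
  have hfin := h T hTm
  rw [hint 2 T hTm] at hfin
  rw [h1]
  refine hfin.trans ?_
  have h5 := mul_le_mul_of_nonneg_right hWT (Real.exp_pos (k * ∫ s in (0:ℝ)..T, X s)).le
  simp only [hW] at h5
  rwa [mul_assoc, ← Real.exp_add, neg_add_cancel, Real.exp_zero, mul_one] at h5

/-! ### Uniform bounds for solutions -/

namespace IsSolution

variable {f : ℝ → ℝ} {c δ ν : ℝ} {ψ₀ : H 2} {T : ℝ} {ψ χ : ℝ → H 2}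

theorem mono (h : IsSolution f c δ ν ψ₀ T ψ χ) {t : ℝ} (ht : t ≤ T) :
    IsSolution f c δ ν ψ₀ t ψ χ where
  continuousOn := h.continuousOn.mono (Icc_subset_Icc_right ht)
  memLp := h.memLp.mono_measure (Measure.restrict_mono_set _ (Ioo_subset_Ioo_right ht))
  dxx_eq := ae_restrict_of_ae_restrict_of_subset (Ioo_subset_Ioo_right ht) h.dxx_eq
  initial := h.initial
  equation := fun φ hφ s hs => h.equation φ hφ s ⟨hs.1, hs.2.trans ht⟩

theorem continuousOn_dx (h : IsSolution f c δ ν ψ₀ T ψ χ) (j : Fin 3) :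
    ContinuousOn (fun t => dx j (ψ t)) (Icc 0 T) :=
  (H.continuous_dx j).comp_continuousOn h.continuousOn

theorem inner_convection (hg : Continuous (deriv f)) (u : H 2) (v : L2) :
    inner ℝ (convection hg c u) v = ∫ x, deriv f (dx 0 u x + c) * dx 1 u x * v x := by
  rw [L2.inner_eq_integral_mul, integral_convection_mul]

theorem integrableOn_norm_sq (h : IsSolution f c δ ν ψ₀ T ψ χ) :
    IntegrableOn (fun t => ‖dx 2 (ψ t)‖ ^ 2) (Ioo 0 T) :=
  (memLp_of_continuousOn (h.continuousOn_dx 2)).integrable_norm_pow two_ne_zero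

/-- The `L²` balance: neither convection nor dispersion contributes. -/
theorem norm_sq_add_integral_le (hf : ContDiff ℝ 2 f) (h : IsSolution f c δ ν ψ₀ T ψ χ)
    (hT : 0 ≤ T) :
    ‖dx 0 (ψ T)‖ ^ 2 + 2 * ν * ∫ t in Ioo 0 T, ‖dx 2 (ψ t)‖ ^ 2 ≤ ‖dx 0 ψ₀‖ ^ 2 := by
  have hE := norm_sq_sub_norm_sq_le hT (u := fun t => dx 0 (ψ t)) (P := fun t => dx 0 (ψ t))
    (A := fun t => dx 0 (ψ t)) (h.continuousOn_dx 0) (h.memLp_timeDeriv hf)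
    (memLp_of_continuousOn (h.continuousOn_dx 0))
    (fun t ht => h.sub_eq_integral_timeDeriv hf ht) (ae_of_all _ fun _ _ _ => rfl)
  have hI : ∫ t in Ioo 0 T, inner ℝ (timeDeriv hf c δ ν ψ χ t) (dx 0 (ψ t)) =
      ∫ t in Ioo 0 T, -ν * ‖dx 2 (ψ t)‖ ^ 2 := by
    refine integral_congr_ae ?_
    filter_upwards [h.dxx_eq] with t ht
    have k0 := hasWeakDeriv_dx_zero (ψ t)
    have k1 := hasWeakDeriv_dx_one (ψ t)
    have k2 := hasWeakDeriv_dx_zero (χ t)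
    have k3 := hasWeakDeriv_dx_one (χ t)
    rw [ht] at k2
    have e3 : inner ℝ (dx 1 (χ t)) (dx 0 (ψ t)) = 0 := by
      rw [k2.inner_left k0, real_inner_comm, k1.inner_self_eq_zero, neg_zero]
    have e4 : inner ℝ (dx 2 (χ t)) (dx 0 (ψ t)) = ‖dx 2 (ψ t)‖ ^ 2 := by
      rw [k3.inner_left k0, k2.inner_left k1, neg_neg, real_inner_self_eq_norm_sq]
    rw [timeDeriv, inner_neg_left, inner_add_left, inner_add_left, real_inner_smul_left,
      real_inner_smul_left, e3, e4, inner_convection,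
      k0.integral_comp_mul_mul_self (hf.continuous_deriv (by norm_num))]
    ring
  rw [hI, integral_const_mul] at hE
  simp only [h.initial] at hE
  linarith

/-- The balance of second derivatives, with the pairing of `∂ₜψ ∈ L²` and `∂ₓ⁴ψ ∈ L²`. -/
theorem norm_dxx_sq_sub_le (hf : ContDiff ℝ 2 f) (h : IsSolution f c δ ν ψ₀ T ψ χ)
    (hT : 0 ≤ T) :
    ‖dx 2 (ψ T)‖ ^ 2 - ‖dx 2 ψ₀‖ ^ 2 ≤
      2 * ∫ t in Ioo 0 T, inner ℝ (timeDeriv hf c δ ν ψ χ t) (dx 2 (χ t)) := by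
  have hE := norm_sq_sub_norm_sq_le hT (u := fun t => dx 0 (ψ t)) (P := fun t => dx 2 (ψ t))
    (A := fun t => dx 2 (χ t)) (h.continuousOn_dx 2) (h.memLp_timeDeriv hf) (h.memLp_dx_χ 2)
    (fun t ht => h.sub_eq_integral_timeDeriv hf ht) (by
      filter_upwards [h.dxx_eq] with t ht s _
      have k2 := hasWeakDeriv_dx_zero (χ t)
      have k3 := hasWeakDeriv_dx_one (χ t)
      have l0 := hasWeakDeriv_dx_zero (ψ t - ψ s)
      have l1 := hasWeakDeriv_dx_one (ψ t - ψ s)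
      rw [← H.dx_sub, ← H.dx_sub, ← ht, l1.inner_left k2, l0.inner_left k3, neg_neg])
  simpa only [h.initial] using hE

/-- The `H²` balance after absorbing the top order part of the convection term. -/
theorem norm_dxx_sq_add_integral_le (hf : ContDiff ℝ 2 f) (h : IsSolution f c δ ν ψ₀ T ψ χ)
    (hT : 0 ≤ T) {C M : ℝ} (hM : ∀ t ∈ Icc 0 T, ‖dx 0 (ψ t)‖ ≤ M)
    (hC : ∀ p₀ p₁ p₂ p₃ p₄ : L2, HasWeakDeriv p₀ p₁ → HasWeakDeriv p₁ p₂ →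
      HasWeakDeriv p₂ p₃ → HasWeakDeriv p₃ p₄ → ‖p₀‖ ≤ M →
      |∫ x, deriv f (p₀ x + c) * p₁ x * p₄ x| ≤
        C * (‖p₂‖ ^ 2 + (‖p₂‖ ^ 2) ^ 2) + ν / 2 * ‖p₄‖ ^ 2) :
    ‖dx 2 (ψ T)‖ ^ 2 + ν * ∫ t in Ioo 0 T, ‖dx 2 (χ t)‖ ^ 2 ≤ ‖dx 2 ψ₀‖ ^ 2 +
      2 * C * ((∫ t in Ioo 0 T, ‖dx 2 (ψ t)‖ ^ 2) + ∫ t in Ioo 0 T, (‖dx 2 (ψ t)‖ ^ 2) ^ 2) := by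
  have i1 := h.integrableOn_norm_sq
  have i2 : IntegrableOn (fun t => (‖dx 2 (ψ t)‖ ^ 2) ^ 2) (Ioo 0 T) :=
    (memLp_of_continuousOn ((h.continuousOn_dx 2).norm.pow 2)).integrable_sq
  have i3 : IntegrableOn (fun t => ‖dx 2 (χ t)‖ ^ 2) (Ioo 0 T) :=
    (h.memLp_dx_χ 2).integrable_norm_pow two_ne_zero
  have i12 : IntegrableOn (fun t => C * (‖dx 2 (ψ t)‖ ^ 2 + (‖dx 2 (ψ t)‖ ^ 2) ^ 2)) (Ioo 0 T) :=
    (i1.add i2).const_mul C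
  have hI : ∫ t in Ioo 0 T, inner ℝ (timeDeriv hf c δ ν ψ χ t) (dx 2 (χ t)) ≤
      ∫ t in Ioo 0 T, (C * (‖dx 2 (ψ t)‖ ^ 2 + (‖dx 2 (ψ t)‖ ^ 2) ^ 2) -
        ν / 2 * ‖dx 2 (χ t)‖ ^ 2) := by
    refine integral_mono_ae (integrable_inner_of_memLp (h.memLp_timeDeriv hf) (h.memLp_dx_χ 2))
      (i12.sub (i3.const_mul _)) ?_
    filter_upwards [h.dxx_eq, ae_restrict_mem measurableSet_Ioo] with t ht htT
    have k0 := hasWeakDeriv_dx_zero (ψ t)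
    have k1 := hasWeakDeriv_dx_one (ψ t)
    have k2 := hasWeakDeriv_dx_zero (χ t)
    have k3 := hasWeakDeriv_dx_one (χ t)
    rw [ht] at k2
    have hb := (abs_le.1 (hC _ _ _ _ _ k0 k1 k2 k3 (hM t ⟨htT.1.le, htT.2.le⟩))).1
    rw [timeDeriv, inner_neg_left, inner_add_left, inner_add_left, real_inner_smul_left,
      real_inner_smul_left, k3.inner_self_eq_zero, real_inner_self_eq_norm_sq, inner_convection]
    linarith
  have hE := h.norm_dxx_sq_sub_le hf hT
  rw [integral_sub i12 (i3.const_mul _), integral_const_mul, integral_const_mul,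
    integral_add i1 i2] at hI
  linarith

/-- Bounds, uniform in `T`, for the quantities that dominate the claimed norms. -/
theorem exists_uniform_bound (hf : ContDiff ℝ 2 f) {q : ℝ} (hq0 : 0 ≤ q) (hq5 : q ≤ 5)
    (hgrowth : ∃ K : ℝ, ∀ u : ℝ, |iteratedDeriv 2 f u| ≤ K * (1 + |u| ^ q))
    (c δ : ℝ) {ν : ℝ} (hν : 0 < ν) (ψ₀ : H 2) :
    ∃ B I J : ℝ, ∀ T : ℝ, 0 ≤ T → ∀ ψ χ : ℝ → H 2, IsSolution f c δ ν ψ₀ T ψ χ →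
      ‖dx 0 (ψ T)‖ ≤ ‖dx 0 ψ₀‖ ∧ ‖dx 2 (ψ T)‖ ^ 2 ≤ B ∧
      ∫ t in Ioo 0 T, ‖dx 2 (ψ t)‖ ^ 2 ≤ I ∧ ∫ t in Ioo 0 T, ‖dx 2 (χ t)‖ ^ 2 ≤ J := by
  obtain ⟨K, hK, hgK⟩ := exists_growth_bound hf hq0 hq5 hgrowth c
  set M := ‖dx 0 ψ₀‖
  obtain ⟨C, hC0, hC⟩ := exists_abs_integral_convection_le (contDiff_deriv hf) c hK hgK
    (norm_nonneg (dx 0 ψ₀)) hν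
  set I := M ^ 2 / (2 * ν) with hI
  have hI0 : 0 ≤ I := by positivity
  set B := (‖dx 2 ψ₀‖ ^ 2 + 2 * C * I) * Real.exp (2 * C * I) with hB
  refine ⟨B, I, (‖dx 2 ψ₀‖ ^ 2 + 2 * C * (I + B * I)) / ν, fun T hT ψ χ h => ?_⟩
  have hn : ∀ t ∈ Icc 0 T, ‖dx 0 (ψ t)‖ ≤ M := fun t ht => by
    have h1 := (h.mono ht.2).norm_sq_add_integral_le hf ht.1
    have h2 : 0 ≤ ∫ s in Ioo 0 t, ‖dx 2 (ψ s)‖ ^ 2 := integral_nonneg fun _ => by positivity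
    exact le_of_sq_le_sq (by nlinarith) (norm_nonneg _)
  have hint : ∀ t ∈ Icc 0 T, ∫ s in Ioo 0 t, ‖dx 2 (ψ s)‖ ^ 2 ≤ I := fun t ht => by
    have h1 := (h.mono ht.2).norm_sq_add_integral_le hf ht.1
    rw [hI, le_div_iff₀ (by positivity)]
    nlinarith [sq_nonneg ‖dx 0 (ψ t)‖]
  have hH := fun t (ht : t ∈ Icc 0 T) => (h.mono ht.2).norm_dxx_sq_add_integral_le hf ht.1
    (fun s hs => hn s ⟨hs.1, hs.2.trans ht.2⟩) hC
  have hconv : ∀ t ∈ Icc 0 T, ∀ Z : ℝ → ℝ, ∫ s in (0:ℝ)..t, Z s = ∫ s in Ioo 0 t, Z s :=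
    fun t ht Z => by rw [intervalIntegral.integral_of_le ht.1, integral_Ioc_eq_integral_Ioo]
  have hY : ∀ t ∈ Icc 0 T, ‖dx 2 (ψ t)‖ ^ 2 ≤ B := fun t ht => by
    have hG := le_mul_exp_of_le_add_integral_sq (Y := fun t => ‖dx 2 (ψ t)‖ ^ 2)
      (B := ‖dx 2 ψ₀‖ ^ 2 + 2 * C * I) (k := 2 * C) ht.1
      (((h.mono ht.2).continuousOn_dx 2).norm.pow 2) (fun _ _ => by positivity) (by positivity)
      (fun s hs => by
        have hsT : s ∈ Icc 0 T := ⟨hs.1, hs.2.trans ht.2⟩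
        rw [hconv s hsT]
        have h1 := hH s hsT
        have h2 : 0 ≤ ν * ∫ r in Ioo 0 s, ‖dx 2 (χ r)‖ ^ 2 :=
          mul_nonneg hν.le (integral_nonneg fun _ => by positivity)
        have h3 := mul_le_mul_of_nonneg_left (hint s hsT) (by positivity : 0 ≤ 2 * C)
        linarith)
    refine hG.trans ?_
    rw [hconv t ht, hB]
    gcongr
    exact hint t ht
  have hTm : T ∈ Icc 0 T := ⟨hT, le_rfl⟩
  refine ⟨hn T hTm, hY T hTm, hint T hTm, ?_⟩
  rw [le_div_iff₀ hν]
  have h1 := hH T hTm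
  have h2 : ∫ t in Ioo 0 T, (‖dx 2 (ψ t)‖ ^ 2) ^ 2 ≤ B * I := by
    have i1 := h.integrableOn_norm_sq
    have hB0 : 0 ≤ B := by positivity
    calc ∫ t in Ioo 0 T, (‖dx 2 (ψ t)‖ ^ 2) ^ 2 ≤ ∫ t in Ioo 0 T, B * ‖dx 2 (ψ t)‖ ^ 2 := by
          refine integral_mono_ae
            (memLp_of_continuousOn ((h.continuousOn_dx 2).norm.pow 2)).integrable_sq
            (i1.const_mul B) ?_
          filter_upwards [ae_restrict_mem measurableSet_Ioo] with t ht
          rw [sq]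
          exact mul_le_mul_of_nonneg_right (hY t ⟨ht.1.le, ht.2.le⟩) (by positivity)
      _ = B * ∫ t in Ioo 0 T, ‖dx 2 (ψ t)‖ ^ 2 := integral_const_mul _ _
      _ ≤ B * I := mul_le_mul_of_nonneg_left (hint T hTm) hB0
  have h3 := mul_le_mul_of_nonneg_left (add_le_add (hint T hTm) h2) (by positivity : 0 ≤ 2 * C)
  have h4 : 0 ≤ ‖dx 2 (ψ T)‖ ^ 2 := by positivity
  linarith

end IsSolution

theorem supNorm_le_of_ae_abs_le {u : L2} {a : ℝ} (h : ∀ᵐ x, |u x| ≤ a) :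
    supNorm u ≤ ENNReal.ofReal a := by
  rw [supNorm, eLpNorm_exponent_top]
  refine eLpNormEssSup_le_of_ae_bound (C := a) ?_
  simpa only [Real.norm_eq_abs] using h

/-- With `s⁴ = ‖∂ₓ²u‖`, the supremum of `|u|` is `O(s)`, and its eighth power is `O(‖∂ₓ²u‖²)`. -/
theorem supNorm_dx_zero_pow_le {u : H 2} {M : ℝ} (hM : ‖dx 0 u‖ ≤ M) :
    supNorm (dx 0 u) ^ 8 ≤ ENNReal.ofReal ((2 * (1 + M)) ^ 8 * ‖dx 2 u‖ ^ 2) := by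
  have hM0 := (norm_nonneg _).trans hM
  obtain ⟨s, hs, hS⟩ := exists_pow_four_eq (norm_nonneg (dx 2 u))
  have h := supNorm_le_of_ae_abs_le
    ((hasWeakDeriv_dx_zero u).ae_abs_le_of_pow_four (hasWeakDeriv_dx_one u) hM hs hS)
  refine (pow_le_pow_left' h 8).trans (le_of_eq ?_)
  rw [← ENNReal.ofReal_pow (by positivity), ← hS]
  congr 1
  ring

/-- With `s⁴ = ‖∂ₓ²u‖`, the supremum of `|∂ₓu|` is `O(s³)`, and its power `8/3` is `O(‖∂ₓ²u‖²)`. -/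
theorem supNorm_dx_one_rpow_le {u : H 2} {M : ℝ} (hM : ‖dx 0 u‖ ≤ M) :
    supNorm (dx 1 u) ^ (8 / 3 : ℝ) ≤
      ENNReal.ofReal ((2 * (1 + M)) ^ (8 / 3 : ℝ) * ‖dx 2 u‖ ^ 2) := by
  have hM0 := (norm_nonneg _).trans hM
  obtain ⟨s, hs, hS⟩ := exists_pow_four_eq (norm_nonneg (dx 2 u))
  have h := supNorm_le_of_ae_abs_le
    ((hasWeakDeriv_dx_zero u).ae_abs_deriv_le_of_pow_four (hasWeakDeriv_dx_one u) hM hs hS)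
  refine (ENNReal.rpow_le_rpow h (by norm_num)).trans (le_of_eq ?_)
  rw [ENNReal.ofReal_rpow_of_nonneg (by positivity) (by norm_num), ← hS,
    Real.mul_rpow (by positivity) (by positivity), ← Real.rpow_natCast s 3, ← Real.rpow_mul hs,
    ← pow_mul, ← Real.rpow_natCast s (4 * 2)]
  norm_num

theorem setLIntegral_le_ofReal {F : ℝ → ℝ≥0∞} {G : ℝ → ℝ} {t a : ℝ}
    (hG : IntegrableOn G (Ioo 0 t)) (hG0 : ∀ s, 0 ≤ G s)
    (hFG : ∀ᵐ s ∂(volume.restrict (Ioo 0 t)), F s ≤ ENNReal.ofReal (G s))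
    (ha : ∫ s in Ioo 0 t, G s ≤ a) : ∫⁻ s in Ioo 0 t, F s ≤ ENNReal.ofReal a := by
  refine (lintegral_mono_ae hFG).trans ?_
  rw [← ofReal_integral_eq_lintegral_ofReal hG (ae_of_all _ hG0)]
  exact ENNReal.ofReal_le_ofReal ha

theorem H.norm_sq_le (u : H 2) : ‖u‖ ^ 2 ≤ 2 * (‖dx 0 u‖ ^ 2 + ‖dx 2 u‖ ^ 2) := by
  rw [H.norm_sq_eq]
  have h := (hasWeakDeriv_dx_zero u).norm_sq_le (hasWeakDeriv_dx_one u)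
  nlinarith [sq_nonneg (‖dx 0 u‖ - ‖dx 2 u‖), sq_nonneg ‖dx 0 u‖, sq_nonneg ‖dx 2 u‖]

theorem H.enorm_sq_eq (u : H 2) : ‖u‖ₑ ^ 2 = ENNReal.ofReal (‖u‖ ^ 2) := by
  rw [ENNReal.ofReal_pow (norm_nonneg _), ofReal_norm]

end DispersiveDiffusive

end

theorem theorem2p3 (f : ℝ → ℝ) (hf : ContDiff ℝ 2 f) (q : ℝ) (hq0 : 0 ≤ q) (hq5 : q ≤ 5)
    (hgrowth : ∃ K : ℝ, ∀ u : ℝ, |iteratedDeriv 2 f u| ≤ K * (1 + |u| ^ q))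
    (uInf δ ν : ℝ) (hν : 0 < ν) (ψ₀ : DispersiveDiffusive.H 2) :
    ∃ C : ℝ, 0 < C ∧ ∀ T : ℝ, 0 < T → ∀ ψ χ : ℝ → DispersiveDiffusive.H 2,
      DispersiveDiffusive.IsSolution f uInf δ ν ψ₀ T ψ χ →
      ∀ t ∈ Icc 0 T,
        ‖ψ t‖ₑ ^ 2 + (∫⁻ τ in Ioo 0 t, ‖χ τ‖ₑ ^ 2)
          + (∫⁻ τ in Ioo 0 t, DispersiveDiffusive.supNorm (DispersiveDiffusive.dx 0 (ψ τ)) ^ 8)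
          + (∫⁻ τ in Ioo 0 t,
              DispersiveDiffusive.supNorm (DispersiveDiffusive.dx 1 (ψ τ)) ^ (8 / 3 : ℝ))
        ≤ ENNReal.ofReal C := by
  open DispersiveDiffusive in
  obtain ⟨B, I, J, hbound⟩ := IsSolution.exists_uniform_bound hf hq0 hq5 hgrowth uInf δ hν ψ₀
  set M := ‖dx 0 ψ₀‖
  set D := 2 * (1 + M) with hD
  have hD0 : 0 ≤ D := by positivity
  set a₁ := 2 * (M ^ 2 + B)
  set a₂ := 2 * (I + J)
  set a₃ := D ^ 8 * I
  set a₄ := D ^ (8 / 3 : ℝ) * I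
  refine ⟨|a₁| + |a₂| + |a₃| + |a₄| + 1, by positivity, fun T _ ψ χ hT t ht => ?_⟩
  have h := hT.mono ht.2
  obtain ⟨b0, b2, bI, bJ⟩ := hbound t ht.1 ψ χ h
  have hn : ∀ᵐ τ ∂(volume.restrict (Ioo 0 t)), ‖dx 0 (ψ τ)‖ ≤ M := by
    filter_upwards [ae_restrict_mem measurableSet_Ioo] with τ hτ
    exact (hbound τ hτ.1.le ψ χ (h.mono hτ.2.le)).1
  have i1 := h.integrableOn_norm_sq
  have i3 : IntegrableOn (fun t => ‖dx 2 (χ t)‖ ^ 2) (Ioo 0 t) :=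
    (h.memLp_dx_χ 2).integrable_norm_pow two_ne_zero
  have i13 : IntegrableOn (fun τ => ‖dx 2 (ψ τ)‖ ^ 2 + ‖dx 2 (χ τ)‖ ^ 2) (Ioo 0 t) := i1.add i3
  have c₁ : ‖ψ t‖ₑ ^ 2 ≤ ENNReal.ofReal |a₁| := by
    rw [H.enorm_sq_eq]
    refine ENNReal.ofReal_le_ofReal (((H.norm_sq_le _).trans ?_).trans (le_abs_self _))
    have : ‖dx 0 (ψ t)‖ ^ 2 ≤ M ^ 2 := by gcongr
    linarith
  have c₂ : ∫⁻ τ in Ioo 0 t, ‖χ τ‖ₑ ^ 2 ≤ ENNReal.ofReal |a₂| := by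
    refine setLIntegral_le_ofReal (G := fun τ => 2 * (‖dx 2 (ψ τ)‖ ^ 2 + ‖dx 2 (χ τ)‖ ^ 2))
      (i13.const_mul 2) (fun _ => by positivity) ?_ ?_
    · filter_upwards [h.dxx_eq] with τ hτ
      rw [H.enorm_sq_eq, ← hτ]
      exact ENNReal.ofReal_le_ofReal (H.norm_sq_le _)
    · rw [integral_const_mul, integral_add i1 i3]
      refine le_trans ?_ (le_abs_self _)
      linarith
  have c₃ : ∫⁻ τ in Ioo 0 t, supNorm (dx 0 (ψ τ)) ^ 8 ≤ ENNReal.ofReal |a₃| := by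
    refine setLIntegral_le_ofReal (i1.const_mul (D ^ 8)) (fun _ => by positivity) ?_ ?_
    · filter_upwards [hn] with τ hτ using supNorm_dx_zero_pow_le hτ
    · rw [integral_const_mul]
      exact (mul_le_mul_of_nonneg_left bI (by positivity)).trans (le_abs_self _)
  have c₄ : ∫⁻ τ in Ioo 0 t, supNorm (dx 1 (ψ τ)) ^ (8 / 3 : ℝ) ≤ ENNReal.ofReal |a₄| := by
    refine setLIntegral_le_ofReal (i1.const_mul (D ^ (8 / 3 : ℝ))) (fun _ => by positivity) ?_ ?_
    · filter_upwards [hn] with τ hτ using supNorm_dx_one_rpow_le hτ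
    · rw [integral_const_mul]
      exact (mul_le_mul_of_nonneg_left bI (by positivity)).trans (le_abs_self _)
  calc _ ≤ ENNReal.ofReal |a₁| + ENNReal.ofReal |a₂| + ENNReal.ofReal |a₃| +
        ENNReal.ofReal |a₄| := add_le_add (add_le_add (add_le_add c₁ c₂) c₃) c₄
    _ = ENNReal.ofReal (|a₁| + |a₂| + |a₃| + |a₄|) := by
      rw [ENNReal.ofReal_add (by positivity) (by positivity),
        ENNReal.ofReal_add (by positivity) (by positivity),
        ENNReal.ofReal_add (by positivity) (by positivity)]
    _ ≤ _ := ENNReal.ofReal_le_ofReal (by linarith)
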